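/- Let $K,N,J\ge 1$. In channel use $n\in\{1,\dots,N\}$ the symbol vector $s_n=(s_{1,n},\dots,s_{K,n})$ is sent over the diagonal channel $y_n=\Delta_n\Sigma_n s_n+w_n$, where $\Delta_n^2=\mathrm{Diag}(\lambda_{1,n},\dots,\lambda_{K,n})$ with channel gains $\lambda_{k,n}>0$, $\Sigma_n^2=\mathrm{Diag}(\sigma_{1,n}^2,\dots,\sigma_{K,n}^2)$ with powers $\sigma^2_{k,n}\ge 0$, and $w_n\sim\mathcal N(0,I_K)$ is independent of $s_n$. The $s_{k,n}$ are real and independent, with an arbitrary law $P_k$ of mean $0$ and variance $1$ that does not depend on $n$. Let $E_n=\mathbb E\{(s_n-\hat s_n)(s_n-\hat s_n)^{T}\}$ with $\hat s_n=\mathbb E\{s_n\mid y_n\}$ be the MMSE matrix. For $x\sim P_k$ and independent $z\sim\mathcal N(0,1)$ let $mmse_k(snr)=\mathbb E\{(x-\mathbb E\{x\mid\sqrt{snr}\,x+z\})^2\}$, let $mmse_k^{-1}(\psi)$ be the $snr\ge 0$ at which $mmse_k$ equals $\psi\in(0,1]$, and let the mercury factor be $G_k(\psi)=1/\psi-mmse_k^{-1}(\psi)$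 for $0<\psi\le 1$ and $G_k(\psi)=1$ for $\psi\ge 1$. Energy packets $\mathcal E_1,\dots,\mathcal E_J\ge 0$ arrive at the beginning of the channel uses $1=e_1<e_2<\dots<e_J\le N$. The $j$-th pool is $\tau_j=\{n: e_j\le n<e_{j+1}\}$ (with $e_{J+1}=N+1$), and $T_s>0$ is the symbol duration. Consider the offline problem of maximizing $\sum_{j=1}^J\sum_{n\in\tau_j} I(s_n;y_n)$ over the powers $\sigma_{k,n}^2\ge 0$ subject to the energy causality constraints $$T_s\sum_{j=1}^{\ell}\sum_{n\in\tau_j}\sum_{k=1}^K\sigma_{k,n}^2\le\sum_{j=1}^{\ell}\mathcal E_j,\qquad \ell=1,\dots,J.$$ This problem has exactly one solution. A feasible allocation is the solution if and only if there are multipliers $\rho_1,\dots,\rho_J\ge 0$ with $\rho_\ell\big(T_s\sum_{j\le\ell}\sum_{n\in\tau_j}\sum_k\sigma^2_{k,n}-\sum_{j\le\ell}\mathcal E_j\big)=0$ for all $\ell$ such that the water levels $W_j=\big(2T_s\sum_{\ell=j}^J\rho_\ell\big)^{-1}$ are well defined (finite and positive) and $$\sigma_{k,n}^2=\Big(W_j-\frac{1}{\lambda_{k,n}}\,G_k\Big(\frac{1}{W_j\lambda_{k,n}}\Big)\Big)^+\qquad\text{for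 all }k,\ j,\ n\in\tau_j .$$ Moreover, for any nonnegative powers and any water levels $W_j>0$, and for every $k$, $j$ and $n\in\tau_j$, this formula is equivalent to each of the following: $\sigma^2_{k,n}=\frac{1}{\lambda_{k,n}}\,mmse_k^{-1}\big(\min\{1,\frac{1}{W_j\lambda_{k,n}}\}\big)$; $[E_n]_{kk}=\min\{1,\frac{1}{\lambda_{k,n}W_j}\}$; and: either $\sigma_{k,n}^2>0$ and $[E_n]_{kk}=\frac{1}{\lambda_{k,n}W_j}$, or $\sigma_{k,n}^2=0$ and $\lambda_{k,n}W_j\le 1$. -/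

import Mathlib

open MeasureTheory ProbabilityTheory
open scoped ENNReal

namespace EnergyHarvesting

/-- The mutual information `I(X; Y)` (in nats): the Kullback-Leibler divergence of the joint law
of `(X, Y)` from the product of the two marginal laws. -/
noncomputable def mutualInfo {Ω α β : Type*} [MeasurableSpace Ω] [MeasurableSpace α]
    [MeasurableSpace β] (μ : Measure Ω) (X : Ω → α) (Y : Ω → β) : ℝ≥0∞ :=
  InformationTheory.klDiv (μ.map fun ω => (X ω, Y ω)) ((μ.map X).prod (μ.map Y))

/-- The conditional mean estimator `E{X | Y}` of a real random variable. -/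
noncomputable def condMean {Ω β : Type*} [mΩ : MeasurableSpace Ω] [mβ : MeasurableSpace β]
    (μ : Measure Ω) (X : Ω → ℝ) (Y : Ω → β) : Ω → ℝ :=
  condExp (mβ.comap Y) μ X

/-- The MMSE matrix `E{(X - E{X | Y}) (X - E{X | Y})ᵀ}`. -/
noncomputable def mmseMatrix {Ω ι β : Type*} [MeasurableSpace Ω] [MeasurableSpace β]
    (μ : Measure Ω) (X : Ω → ι → ℝ) (Y : Ω → β) : Matrix ι ι ℝ :=
  Matrix.of fun k l =>
    ∫ ω, (X ω k - condMean μ (fun ω => X ω k) Y ω) *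
      (X ω l - condMean μ (fun ω => X ω l) Y ω) ∂μ

/-! ### The scalar channel `√snr * x + n` -/

/-- `mmse(snr) = E{(x - E{x | √snr x + n})²}`, where `x` has law `P` and `n` is an independent
standard Gaussian. -/
noncomputable def mmse (P : Measure ℝ) (snr : ℝ) : ℝ :=
  ∫ ω : ℝ × ℝ,
    (ω.1 - condMean (P.prod (gaussianReal 0 1)) Prod.fst (fun ω => √snr * ω.1 + ω.2) ω) ^ 2
      ∂(P.prod (gaussianReal 0 1))

/-- The inverse MMSE function: the signal-to-noise ratio `snr ≥ 0` at which the MMSE is `ψ`. -/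
noncomputable def mmseInv (P : Measure ℝ) (ψ : ℝ) : ℝ :=
  sInf {snr : ℝ | 0 ≤ snr ∧ mmse P snr = ψ}

/-- The mercury factor `G(ψ)`. -/
noncomputable def mercuryFactor (P : Measure ℝ) (ψ : ℝ) : ℝ :=
  if ψ ≤ 1 then 1 / ψ - mmseInv P ψ else 1

/-! ### One use of the diagonal vector channel -/

/-- The joint law of the symbol vector, with independent components of laws `P k`, and of the
independent Gaussian noise vector with identity covariance. -/
noncomputable def symbolNoiseLaw {K : ℕ} (P : Fin K → Measure ℝ) :
    Measure ((Fin K → ℝ) × (Fin K → ℝ)) :=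
  (Measure.pi P).prod (Measure.pi fun _ => gaussianReal 0 1)

/-- The received vector `y = Δ Σ s + w` for `ω = (s, w)`, where `Δ² = Diag(lam)` holds the channel
gains and `Σ² = Diag(q)` the transmitted powers. -/
noncomputable def received {K : ℕ} (lam q : Fin K → ℝ) (ω : (Fin K → ℝ) × (Fin K → ℝ)) :
    Fin K → ℝ :=
  (Matrix.diagonal (fun k => √(lam k)) * Matrix.diagonal (fun k => √(q k))).mulVec ω.1 + ω.2

/-- The mutual information `I(s; y)` of one channel use. -/
noncomputable def channelInfo {K : ℕ} (P : Fin K → Measure ℝ) (lam q : Fin K → ℝ) : ℝ≥0∞ :=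
  mutualInfo (symbolNoiseLaw P) Prod.fst (received lam q)

/-- The MMSE matrix of one channel use. -/
noncomputable def channelMMSE {K : ℕ} (P : Fin K → Measure ℝ) (lam q : Fin K → ℝ) :
    Matrix (Fin K) (Fin K) ℝ :=
  mmseMatrix (symbolNoiseLaw P) Prod.fst (received lam q)

/-! ### The throughput maximization problem -/

/-- The `j`-th pool: the channel accesses from the `j`-th energy arrival (included) up to the next
arrival (excluded); `e j` is the channel access at the beginning of which packet `j` arrives. -/
def pool {N J : ℕ} (e : Fin J → Fin N) (j : Fin J) : Finset (Fin N) :=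
  Finset.univ.filter fun n => e j ≤ n ∧ ∀ i, j < i → n < e i

/-- The total mutual information of the allocation `p`, with `p k n` the power `σ²_{k,n}`. -/
noncomputable def totalInfo {K N J : ℕ} (P : Fin K → Measure ℝ) (lam : Fin K → Fin N → ℝ)
    (e : Fin J → Fin N) (p : Fin K → Fin N → ℝ) : ℝ≥0∞ :=
  ∑ j, ∑ n ∈ pool e j, channelInfo P (fun k => lam k n) (fun k => p k n)

/-- The energy spent in the pools up to and including the `l`-th. -/
noncomputable def spentEnergy {K N J : ℕ} (Ts : ℝ) (e : Fin J → Fin N) (p : Fin K → Fin N → ℝ)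
    (l : Fin J) : ℝ :=
  Ts * ∑ j ∈ Finset.Iic l, ∑ n ∈ pool e j, ∑ k, p k n

/-- The energy harvested in the packets up to and including the `l`-th. -/
noncomputable def harvestedEnergy {J : ℕ} (E : Fin J → ℝ) (l : Fin J) : ℝ :=
  ∑ j ∈ Finset.Iic l, E j

/-- Nonnegative powers that satisfy the energy causality constraints. -/
def IsFeasible {K N J : ℕ} (Ts : ℝ) (E : Fin J → ℝ) (e : Fin J → Fin N)
    (p : Fin K → Fin N → ℝ) : Prop :=
  (∀ k n, 0 ≤ p k n) ∧ ∀ l, spentEnergy Ts e p l ≤ harvestedEnergy E l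

/-- `p` maximizes the total mutual information among all feasible allocations. -/
def IsOptimal {K N J : ℕ} (P : Fin K → Measure ℝ) (lam : Fin K → Fin N → ℝ) (Ts : ℝ)
    (E : Fin J → ℝ) (e : Fin J → Fin N) (p : Fin K → Fin N → ℝ) : Prop :=
  IsFeasible Ts E e p ∧ ∀ q, IsFeasible Ts E e q → totalInfo P lam e q ≤ totalInfo P lam e p

/-- The water level of pool `j` for the multipliers `ρ` of the energy causality constraints. -/
noncomputable def waterLevel {J : ℕ} (Ts : ℝ) (ρ : Fin J → ℝ) (j : Fin J) : ℝ :=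
  1 / (2 * Ts * ∑ l ∈ Finset.Ici j, ρ l)

end EnergyHarvesting

/-!
The problem splits into information theory of a scalar Gaussian channel and a concave program.

*The scalar channel.* At amplitude `t` the law of the output given the symbol `u` has density
`exp (t * u * y - t ^ 2 * u ^ 2 / 2)` with respect to the standard Gaussian law, which serves as
reference measure throughout. Bayes' formula (`HasTransitionDensity.condMean_ae_eq`) turns
conditional means into quotients of integrals against this density, and the mutual information
is the mean of the logarithm of the likelihood ratio (`HasTransitionDensity.mutualInfo_eq`). The
same two statements, applied to the product density, reduce the diagonal vector channel to its
streams (`channelMMSE_apply_self`, `channelInfo_eq`).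

*Monotonicity of the MMSE.* By orthogonality the MMSE is one minus the power of the estimator. A
channel of smaller amplitude is a degraded version of one with a larger amplitude: its output
density is the image of the other under a Gaussian averaging
(`IsStandardized.integral_tiltedMoment_mix`). The estimator power lost this way is a mean square
that vanishes only if the estimator is constant, which a symbol of positive variance rules out
(`IsStandardized.strictMonoOn_estimatorPower`). The MMSE is continuous by a dominated convergence
argument in which the posterior second moment, of constant mean, dominates the squared estimator.
Hence it decreases strictly from one to zero and the inverse is well defined.

*Information and MMSE.* For a fixed symbol and noise, the logarithm of the output density is
differentiable in the amplitude, with a derivative of mean `t * estimatorPower P t`. The fundamental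
theorem of calculus and Fubini's theorem then give the mutual information as half the integral of
the MMSE (`IsStandardized.gaussInfo_sqrt`), for every symbol law with mean zero and unit power.

*The concave program.* The rate of a stream is thus a function with a positive, strictly decreasing
derivative. Existence of a maximizer is compactness, uniqueness is strict concavity, and sufficiency
of the multipliers follows from the tangent inequality. For necessity
(`IsBudgetOptimal.exists_prices`), the price of a pool is the largest marginal rate at or after it,
and the multipliers are the drops of this price: energy can always be postponed, so that powered
streams are at the price of their pool, and it can be advanced across any constraint with slack, so
that the price drops only at tight constraints. Stationarity is the water-filling rule by
`IsStandardized.waterfilling_iff_stationary`.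
-/

namespace EnergyHarvesting

/-! ### Bayes' formula for a channel with a transition density -/

section Bayes

set_option linter.unusedSectionVars false

variable {A B : Type*} [MeasurableSpace A] [MeasurableSpace B]

/-- The output `Y` of a channel with input `ω.1` and noise `ω.2` has the positive transition
density `κ (a, b)` with respect to `ν`, integrable in the input at every output. The noise law `ν`
also serves as the reference measure on the output space. -/
structure HasTransitionDensity (μ : Measure A) (ν : Measure B) (Y : A × B → B)
    (κ : A × B → ℝ) : Prop where
  measurable_output : Measurable Y
  measurable_density : Measurable κ
  density_pos : ∀ p, 0 < κ p
  integrable_density : ∀ b, Integrable (fun a => κ (a, b)) μ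
  map_eq : (μ.prod ν).map (fun ω => (ω.1, Y ω)) =
    (μ.prod ν).withDensity fun p => ENNReal.ofReal (κ p)

/-- The density of the channel output with respect to the reference measure. -/
noncomputable def outputDensity (μ : Measure A) (κ : A × B → ℝ) (b : B) : ℝ :=
  ∫ a, κ (a, b) ∂μ

/-- The mean of `f` under the conditional law of the input given the output `b`. -/
noncomputable def posteriorMean (μ : Measure A) (κ : A × B → ℝ) (f : A → ℝ) (b : B) : ℝ :=
  (∫ a, f a * κ (a, b) ∂μ) / outputDensity μ κ b

namespace HasTransitionDensity

variable {μ : Measure A} {ν : Measure B} [IsProbabilityMeasure μ] [IsProbabilityMeasure ν]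
  {Y : A × B → B} {κ : A × B → ℝ}

lemma measurable_pair (hκ : HasTransitionDensity μ ν Y κ) :
    Measurable fun ω : A × B => (ω.1, Y ω) :=
  measurable_fst.prodMk hκ.measurable_output

lemma integrable_comp_iff (hκ : HasTransitionDensity μ ν Y κ) {F : A × B → ℝ}
    (hF : Measurable F) :
    Integrable (fun ω => F (ω.1, Y ω)) (μ.prod ν) ↔
      Integrable (fun p => κ p * F p) (μ.prod ν) := by
  have h := integrable_map_measure (μ := μ.prod ν) (f := fun ω : A × B => (ω.1, Y ω))
    (g := F) hF.aestronglyMeasurable hκ.measurable_pair.aemeasurable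
  rw [hκ.map_eq, integrable_withDensity_iff_integrable_smul'
    hκ.measurable_density.ennreal_ofReal (by simp)] at h
  rw [show (fun ω => F (ω.1, Y ω)) = F ∘ fun ω : A × B => (ω.1, Y ω) from rfl, ← h]
  simp [ENNReal.toReal_ofReal (hκ.density_pos _).le]

lemma integral_comp (hκ : HasTransitionDensity μ ν Y κ) {F : A × B → ℝ} (hF : Measurable F) :
    ∫ ω, F (ω.1, Y ω) ∂(μ.prod ν) = ∫ p, κ p * F p ∂(μ.prod ν) := by
  have h := integral_map (μ := μ.prod ν) (φ := fun ω : A × B => (ω.1, Y ω))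
    hκ.measurable_pair.aemeasurable (f := F) hF.aestronglyMeasurable
  rw [← h, hκ.map_eq, integral_withDensity_eq_integral_toReal_smul
    hκ.measurable_density.ennreal_ofReal (by simp)]
  simp [ENNReal.toReal_ofReal (hκ.density_pos _).le]

lemma outputDensity_pos (hκ : HasTransitionDensity μ ν Y κ) (b : B) :
    0 < outputDensity μ κ b := by
  refine (integral_pos_iff_support_of_nonneg (fun a => (hκ.density_pos _).le)
    (hκ.integrable_density b)).2 ?_
  rw [show Function.support (fun a => κ (a, b)) = Set.univ from
    Set.eq_univ_of_forall fun a => (hκ.density_pos _).ne']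
  simp

lemma measurable_outputDensity (hκ : HasTransitionDensity μ ν Y κ) :
    Measurable (outputDensity μ κ) :=
  (hκ.measurable_density.stronglyMeasurable.integral_prod_left').measurable

lemma measurable_posteriorMean (hκ : HasTransitionDensity μ ν Y κ) {f : A → ℝ}
    (hf : Measurable f) : Measurable (posteriorMean μ κ f) := by
  refine Measurable.div ?_ hκ.measurable_outputDensity
  exact (((hf.comp measurable_fst).mul
    hκ.measurable_density).stronglyMeasurable.integral_prod_left').measurable

lemma posteriorMean_mul_outputDensity (hκ : HasTransitionDensity μ ν Y κ) (f : A → ℝ) (b : B) :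
    posteriorMean μ κ f b * outputDensity μ κ b = ∫ a, f a * κ (a, b) ∂μ :=
  div_mul_cancel₀ _ (hκ.outputDensity_pos b).ne'

/-- The law of the output has density `outputDensity μ κ`. -/
lemma map_output (hκ : HasTransitionDensity μ ν Y κ) :
    (μ.prod ν).map Y = ν.withDensity fun b => ENNReal.ofReal (outputDensity μ κ b) := by
  have h1 : (μ.prod ν).map Y = ((μ.prod ν).map (fun ω => (ω.1, Y ω))).map Prod.snd := by
    rw [Measure.map_map measurable_snd hκ.measurable_pair]; rfl
  rw [h1, hκ.map_eq]
  ext s hs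
  rw [Measure.map_apply measurable_snd hs, withDensity_apply _ (measurable_snd hs),
    withDensity_apply _ hs, show Prod.snd ⁻¹' s = (Set.univ : Set A) ×ˢ s by ext; simp,
    ← Measure.prod_restrict, Measure.restrict_univ,
    lintegral_prod_symm' _ hκ.measurable_density.ennreal_ofReal]
  refine lintegral_congr fun b => ?_
  rw [outputDensity, ofReal_integral_eq_lintegral_ofReal (hκ.integrable_density b)
    (ae_of_all _ fun a => (hκ.density_pos _).le)]

lemma integrable_posteriorMean (hκ : HasTransitionDensity μ ν Y κ) {f : A → ℝ}
    (hf : Measurable f) (hfi : Integrable f μ) :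
    Integrable (fun ω => posteriorMean μ κ f (Y ω)) (μ.prod ν) := by
  have h1 : Integrable (fun p : A × B => κ p * f p.1) (μ.prod ν) :=
    (hκ.integrable_comp_iff (F := fun p => f p.1) (hf.comp measurable_fst)).1 (hfi.comp_fst ν)
  have hm : Measurable fun p : A × B => posteriorMean μ κ f p.2 :=
    (hκ.measurable_posteriorMean hf).comp measurable_snd
  refine (hκ.integrable_comp_iff (F := fun p => posteriorMean μ κ f p.2) hm).2 ?_
  refine (integrable_prod_iff' (hκ.measurable_density.mul hm).aestronglyMeasurable).2 ⟨?_, ?_⟩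
  · exact ae_of_all _ fun b => (hκ.integrable_density b).mul_const (posteriorMean μ κ f b)
  · refine (h1.integral_prod_right.norm).congr (ae_of_all _ fun b => ?_)
    have h2 : ∀ a, ‖κ (a, b) * posteriorMean μ κ f b‖ = κ (a, b) * ‖posteriorMean μ κ f b‖ :=
      fun a => by rw [norm_mul, Real.norm_of_nonneg (hκ.density_pos _).le]
    simp only [Pi.mul_apply, h2]
    rw [integral_mul_const]
    change _ = outputDensity μ κ b * _
    rw [← Real.norm_of_nonneg (hκ.outputDensity_pos b).le, ← norm_mul,
      mul_comm (outputDensity μ κ b), hκ.posteriorMean_mul_outputDensity]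
    simp only [mul_comm]

/-- Bayes' formula: the posterior mean is a version of the conditional expectation. -/
lemma condMean_ae_eq (hκ : HasTransitionDensity μ ν Y κ) {f : A → ℝ}
    (hf : Measurable f) (hfi : Integrable f μ) :
    condMean (μ.prod ν) (fun ω => f ω.1) Y =ᵐ[μ.prod ν] fun ω => posteriorMean μ κ f (Y ω) := by
  have hi := hκ.integrable_posteriorMean hf hfi
  symm
  refine ae_eq_condExp_of_forall_setIntegral_eq hκ.measurable_output.comap_le (hfi.comp_fst ν)
    (fun s _ _ => hi.integrableOn) ?_ ?_
  · rintro _ ⟨s, hs, rfl⟩ -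
    have hms := hκ.measurable_output hs
    rw [← integral_indicator hms, ← integral_indicator hms]
    have hs2 : MeasurableSet (Prod.snd ⁻¹' s : Set (A × B)) := measurable_snd hs
    have hm1 : Measurable ((Prod.snd ⁻¹' s : Set (A × B)).indicator fun p => f p.1) :=
      (hf.comp measurable_fst).indicator hs2
    have hm2 : Measurable ((Prod.snd ⁻¹' s : Set (A × B)).indicator
        fun p => posteriorMean μ κ f p.2) :=
      ((hκ.measurable_posteriorMean hf).comp measurable_snd).indicator hs2
    have e1 := hκ.integral_comp hm1
    have e2 := hκ.integral_comp hm2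
    have i1 := (hκ.integrable_comp_iff hm1).1 ((hfi.comp_fst ν).indicator hms)
    have i2 := (hκ.integrable_comp_iff hm2).1 (hi.indicator hms)
    refine e2.trans (Eq.trans ?_ e1.symm)
    rw [integral_prod_symm _ i1, integral_prod_symm _ i2]
    refine integral_congr_ae (ae_of_all _ fun b => ?_)
    by_cases hb : b ∈ s
    · simp only [Set.indicator, Set.mem_preimage, hb, if_true]
      rw [integral_mul_const, mul_comm]
      refine (hκ.posteriorMean_mul_outputDensity f b).trans ?_
      simp only [mul_comm]
    · simp [Set.indicator, hb]
  · exact ((hκ.measurable_posteriorMean hf).comp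
      (comap_measurable Y)).stronglyMeasurable.aestronglyMeasurable

lemma integral_mul_posteriorMean (hκ : HasTransitionDensity μ ν Y κ) {f : A → ℝ} {g : B → ℝ}
    (hf : Measurable f) (hfi : Integrable f μ) (hg : Measurable g)
    (hgf : Integrable (fun ω => g (Y ω) * f ω.1) (μ.prod ν)) :
    ∫ ω, g (Y ω) * posteriorMean μ κ f (Y ω) ∂(μ.prod ν) = ∫ ω, g (Y ω) * f ω.1 ∂(μ.prod ν) := by
  rw [← integral_condExp (f := fun ω => g (Y ω) * f ω.1) hκ.measurable_output.comap_le]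
  have hgm : StronglyMeasurable[MeasurableSpace.comap Y inferInstance] fun ω => g (Y ω) :=
    (hg.comp (comap_measurable Y)).stronglyMeasurable
  have h := condExp_mul_of_stronglyMeasurable_left hgm hgf (hfi.comp_fst ν)
  refine integral_congr_ae ?_
  filter_upwards [h, hκ.condMean_ae_eq hf hfi] with ω h1 h2
  rw [← h2]
  exact h1.symm

/-- The mutual information is the mean of the logarithm of the transition density relative to the
output density. -/
lemma mutualInfo_eq (hκ : HasTransitionDensity μ ν Y κ)
    (hi : Integrable (fun ω => Real.log (κ (ω.1, Y ω) / outputDensity μ κ (Y ω))) (μ.prod ν)) :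
    mutualInfo (μ.prod ν) Prod.fst Y = ENNReal.ofReal
      (∫ ω, Real.log (κ (ω.1, Y ω) / outputDensity μ κ (Y ω)) ∂(μ.prod ν)) := by
  set R : Measure (A × B) := ((μ.prod ν).map Prod.fst).prod ((μ.prod ν).map Y) with hR
  have hY := hκ.measurable_output
  have hp : IsProbabilityMeasure ((μ.prod ν).map Y) :=
    Measure.isProbabilityMeasure_map hY.aemeasurable
  have hp1 : IsProbabilityMeasure ((μ.prod ν).map Prod.fst) :=
    Measure.isProbabilityMeasure_map measurable_fst.aemeasurable
  have hp2 : IsProbabilityMeasure ((μ.prod ν).map fun ω => (ω.1, Y ω)) :=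
    Measure.isProbabilityMeasure_map hκ.measurable_pair.aemeasurable
  have hho : Measurable fun p : A × B => outputDensity μ κ p.2 :=
    hκ.measurable_outputDensity.comp measurable_snd
  have hR2 : R = (μ.prod ν).withDensity fun p => ENNReal.ofReal (outputDensity μ κ p.2) := by
    rw [hR, Measure.map_fst_prod, measure_univ, one_smul, hκ.map_output,
      prod_withDensity_right hκ.measurable_outputDensity.ennreal_ofReal]
  set r : A × B → ℝ := fun p => κ p / outputDensity μ κ p.2 with hr
  have hrm : Measurable r := hκ.measurable_density.div hho
  have hJ : (μ.prod ν).map (fun ω => (ω.1, Y ω)) = R.withDensity fun p => ENNReal.ofReal (r p) := by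
    rw [hR2, ← withDensity_mul _ hho.ennreal_ofReal hrm.ennreal_ofReal, hκ.map_eq]
    congr 1
    funext p
    rw [Pi.mul_apply, ← ENNReal.ofReal_mul (hκ.outputDensity_pos _).le, hr]
    simp only
    rw [mul_div_cancel₀ _ (hκ.outputDensity_pos _).ne']
  have hac : (μ.prod ν).map (fun ω => (ω.1, Y ω)) ≪ R := by
    rw [hJ]; exact withDensity_absolutelyContinuous _ _
  have hllr : llr ((μ.prod ν).map fun ω => (ω.1, Y ω)) R
      =ᵐ[(μ.prod ν).map fun ω => (ω.1, Y ω)] fun p => Real.log (r p) := by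
    refine hac.ae_le ?_
    have := Measure.rnDeriv_withDensity R hrm.ennreal_ofReal
    rw [← hJ] at this
    filter_upwards [this] with p hpp
    rw [llr, hpp, ENNReal.toReal_ofReal
      (div_nonneg (hκ.density_pos _).le (hκ.outputDensity_pos _).le)]
  have hlm : Measurable fun p => Real.log (r p) := Real.measurable_log.comp hrm
  have hint : Integrable (llr ((μ.prod ν).map fun ω => (ω.1, Y ω)) R)
      ((μ.prod ν).map fun ω => (ω.1, Y ω)) := by
    refine Integrable.congr ?_ hllr.symm
    exact (integrable_map_measure hlm.aestronglyMeasurable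
      hκ.measurable_pair.aemeasurable).2 hi
  rw [mutualInfo, InformationTheory.klDiv_of_ac_of_integrable hac hint, integral_congr_ae hllr,
    integral_map hκ.measurable_pair.aemeasurable hlm.aestronglyMeasurable]
  simp [hr]

/-- A channel whose output law given the input `a` has density `κ (a, ·)`. -/
lemma of_map_eq (hY : Measurable Y) (hκ : Measurable κ) (h0 : ∀ p, 0 < κ p)
    (hint : ∀ b, Integrable (fun a => κ (a, b)) μ)
    (hmap : ∀ a, ν.map (fun b => Y (a, b)) = ν.withDensity fun b => ENNReal.ofReal (κ (a, b))) :
    HasTransitionDensity μ ν Y κ where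
  measurable_output := hY
  measurable_density := hκ
  density_pos := h0
  integrable_density := hint
  map_eq := by
    have hpm : Measurable fun ω : A × B => (ω.1, Y ω) := measurable_fst.prodMk hY
    ext s hs
    rw [Measure.map_apply hpm hs, withDensity_apply _ hs, ← lintegral_indicator hs,
      lintegral_prod _ ((hκ.ennreal_ofReal.indicator hs).aemeasurable),
      Measure.prod_apply (hpm hs)]
    refine lintegral_congr fun a => ?_
    have hsa : MeasurableSet (Prod.mk a ⁻¹' s) := measurable_prodMk_left hs
    have hYa : Measurable fun b => Y (a, b) := hY.comp measurable_prodMk_left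
    have e : Prod.mk a ⁻¹' ((fun ω : A × B => (ω.1, Y ω)) ⁻¹' s)
        = (fun b => Y (a, b)) ⁻¹' (Prod.mk a ⁻¹' s) := rfl
    rw [e, ← Measure.map_apply hYa hsa, hmap, withDensity_apply _ hsa, ← lintegral_indicator hsa]
    rfl

end HasTransitionDensity

end Bayes

/-! ### The scalar Gaussian channel -/

section ScalarChannel

set_option linter.unusedSectionVars false

/-- The law of a real symbol with mean zero and unit power. -/
structure IsStandardized (P : Measure ℝ) : Prop where
  mean : ∫ x, x ∂P = 0
  power : ∫ x, x ^ 2 ∂P = 1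

/-- The density at `y` of the law of `t * u + n`, with `n` standard Gaussian, with respect to the
standard Gaussian law; here `p = (u, y)`. -/
noncomputable def gaussDensity (t : ℝ) (p : ℝ × ℝ) : ℝ :=
  Real.exp (t * p.1 * p.2 - t ^ 2 * p.1 ^ 2 / 2)

/-- The unnormalized posterior moment of order `j` of the symbol when `t * u + n = y` is
observed. -/
noncomputable def tiltedMoment (P : Measure ℝ) (j : ℕ) (t y : ℝ) : ℝ :=
  ∫ u, u ^ j * gaussDensity t (u, y) ∂P

/-- The posterior moment of order `j` of the symbol when `t * u + n = y` is observed. -/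
noncomputable def posteriorMoment (P : Measure ℝ) (j : ℕ) (t y : ℝ) : ℝ :=
  tiltedMoment P j t y / tiltedMoment P 0 t y

lemma gaussDensity_pos (t : ℝ) (p : ℝ × ℝ) : 0 < gaussDensity t p := Real.exp_pos _

lemma gaussDensity_le (t u y : ℝ) : gaussDensity t (u, y) ≤ Real.exp (y ^ 2 / 2) :=
  Real.exp_le_exp.2 (by nlinarith [sq_nonneg (t * u - y)])

lemma gaussianReal_eq_withDensity (m : ℝ) :
    gaussianReal m 1 = (gaussianReal 0 1).withDensity
      fun y => ENNReal.ofReal (Real.exp (m * y - m ^ 2 / 2)) := by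
  rw [gaussianReal_of_var_ne_zero m one_ne_zero, gaussianReal_of_var_ne_zero 0 one_ne_zero,
    ← withDensity_mul _ (measurable_gaussianPDF 0 1) (by fun_prop)]
  congr 1
  funext y
  rw [Pi.mul_apply, gaussianPDF, gaussianPDF, ← ENNReal.ofReal_mul (gaussianPDFReal_nonneg 0 1 y),
    gaussianPDFReal, gaussianPDFReal, mul_assoc _ (Real.exp _), ← Real.exp_add]
  congr 3
  simp only [NNReal.coe_one]
  ring

lemma gaussianReal_map_add_eq_withDensity (t u : ℝ) :
    (gaussianReal 0 1).map (fun z => t * u + z) = (gaussianReal 0 1).withDensity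
      fun y => ENNReal.ofReal (gaussDensity t (u, y)) := by
  rw [gaussianReal_map_const_add, zero_add, gaussianReal_eq_withDensity]
  congr 1
  funext y
  rw [gaussDensity, mul_pow]

lemma integrable_sq_gaussianReal : Integrable (fun z : ℝ => z ^ 2) (gaussianReal 0 1) :=
  (memLp_id_gaussianReal 2).integrable_sq

lemma integral_sq_gaussianReal : ∫ z : ℝ, z ^ 2 ∂(gaussianReal 0 1) = 1 := by
  have h := variance_fun_id_gaussianReal (μ := 0) (v := 1)
  rw [variance_eq_integral measurable_id'.aemeasurable] at h
  simpa [integral_id_gaussianReal] using h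

variable {P : Measure ℝ} [IsProbabilityMeasure P]

lemma IsStandardized.integrable_sq (hP : IsStandardized P) : Integrable (fun x : ℝ => x ^ 2) P := by
  -- A function that is not integrable has integral zero, which is not the power.
  by_contra h
  have := hP.power
  rw [integral_undef h] at this
  exact zero_ne_one this

lemma IsStandardized.integrable_pow (hP : IsStandardized P) {j : ℕ} (hj : j ≤ 2) :
    Integrable (fun x : ℝ => x ^ j) P := by
  refine ((integrable_const (1 : ℝ)).add hP.integrable_sq).mono'
    (by fun_prop) (ae_of_all _ fun x => ?_)
  simp only [Real.norm_eq_abs, abs_pow, Pi.add_apply]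
  interval_cases j
  · simpa using sq_nonneg x
  · nlinarith [sq_nonneg (|x| - 1), sq_abs x, abs_nonneg x]
  · rw [sq_abs]; linarith

lemma IsStandardized.integrable_id (hP : IsStandardized P) : Integrable (fun x : ℝ => x) P := by
  simpa using hP.integrable_pow one_le_two

lemma norm_pow_mul_gaussDensity_le (j : ℕ) (t u y : ℝ) :
    ‖u ^ j * gaussDensity t (u, y)‖ ≤ ‖u ^ j‖ * Real.exp (y ^ 2 / 2) := by
  rw [norm_mul, Real.norm_of_nonneg (gaussDensity_pos t _).le]
  exact mul_le_mul_of_nonneg_left (gaussDensity_le t u y) (norm_nonneg _)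

lemma measurable_gaussDensity (t : ℝ) : Measurable (gaussDensity t) := by
  unfold gaussDensity; fun_prop

lemma IsStandardized.integrable_tilted (hP : IsStandardized P) {j : ℕ} (hj : j ≤ 2) (t y : ℝ) :
    Integrable (fun u => u ^ j * gaussDensity t (u, y)) P :=
  ((hP.integrable_pow hj).norm.mul_const (Real.exp (y ^ 2 / 2))).mono'
    (by unfold gaussDensity; fun_prop) (ae_of_all _ fun u => norm_pow_mul_gaussDensity_le j t u y)

lemma IsStandardized.continuous_tiltedMoment (hP : IsStandardized P) {j : ℕ} (hj : j ≤ 2) :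
    Continuous fun q : ℝ × ℝ => tiltedMoment P j q.1 q.2 := by
  refine continuous_iff_continuousAt.2 fun q₀ => ?_
  refine continuousAt_of_dominated (bound := fun u => ‖u ^ j‖ * Real.exp ((q₀.2 ^ 2 + 1) / 2))
    (Filter.Eventually.of_forall fun q => by unfold gaussDensity; fun_prop) ?_
    ((hP.integrable_pow hj).norm.mul_const _)
    (ae_of_all _ fun u => by unfold gaussDensity; fun_prop)
  have h : ∀ᶠ q : ℝ × ℝ in nhds q₀, q.2 ^ 2 < q₀.2 ^ 2 + 1 := by
    have : Continuous fun q : ℝ × ℝ => q.2 ^ 2 := by fun_prop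
    exact this.continuousAt.eventually_lt continuousAt_const (by simp)
  filter_upwards [h] with q hq
  refine ae_of_all _ fun u => (norm_pow_mul_gaussDensity_le j q.1 u q.2).trans ?_
  gcongr

/-- The Gaussian channel with amplitude `t`. -/
lemma hasTransitionDensity_gauss (hP : IsStandardized P) (t : ℝ) :
    HasTransitionDensity P (gaussianReal 0 1) (fun ω => t * ω.1 + ω.2) (gaussDensity t) :=
  .of_map_eq (by fun_prop) (measurable_gaussDensity t) (gaussDensity_pos t)
    (fun y => by simpa using hP.integrable_tilted (Nat.zero_le 2) t y)
    (gaussianReal_map_add_eq_withDensity t)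

lemma outputDensity_gauss (t y : ℝ) :
    outputDensity P (gaussDensity t) y = tiltedMoment P 0 t y := by
  simp [outputDensity, tiltedMoment]

lemma posteriorMean_gauss (j : ℕ) (t y : ℝ) :
    posteriorMean P (gaussDensity t) (fun u => u ^ j) y = posteriorMoment P j t y := by
  rw [posteriorMean, outputDensity_gauss]; rfl

lemma posteriorMean_gauss_id (t y : ℝ) :
    posteriorMean P (gaussDensity t) (fun u => u) y = posteriorMoment P 1 t y := by
  simpa using posteriorMean_gauss (P := P) 1 t y

lemma IsStandardized.tiltedMoment_zero_pos (hP : IsStandardized P) (t y : ℝ) :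
    0 < tiltedMoment P 0 t y := by
  rw [← outputDensity_gauss]; exact (hasTransitionDensity_gauss hP t).outputDensity_pos y

lemma IsStandardized.continuous_posteriorMoment (hP : IsStandardized P) {j : ℕ} (hj : j ≤ 2) :
    Continuous fun q : ℝ × ℝ => posteriorMoment P j q.1 q.2 :=
  (hP.continuous_tiltedMoment hj).div (hP.continuous_tiltedMoment (Nat.zero_le 2))
    fun _ => (hP.tiltedMoment_zero_pos _ _).ne'

/-- The second moment of `u - c` under the unnormalized posterior law. -/
lemma IsStandardized.integral_sub_sq_mul (hP : IsStandardized P) (t y c : ℝ) :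
    ∫ u, (u - c) ^ 2 * gaussDensity t (u, y) ∂P =
      tiltedMoment P 2 t y - 2 * c * tiltedMoment P 1 t y + c ^ 2 * tiltedMoment P 0 t y := by
  simp only [tiltedMoment]
  rw [← integral_const_mul, ← integral_const_mul, ← integral_sub, ← integral_add]
  · exact integral_congr_ae (ae_of_all _ fun u => by simp only; ring)
  · exact (hP.integrable_tilted le_rfl t y).sub
      ((hP.integrable_tilted one_le_two t y).const_mul _)
  · exact (hP.integrable_tilted (Nat.zero_le 2) t y).const_mul _
  · exact hP.integrable_tilted le_rfl t y
  · exact (hP.integrable_tilted one_le_two t y).const_mul _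

lemma IsStandardized.posteriorMoment_one_sq_le (hP : IsStandardized P) (t y : ℝ) :
    posteriorMoment P 1 t y ^ 2 ≤ posteriorMoment P 2 t y := by
  have h0 := hP.tiltedMoment_zero_pos t y
  have h := hP.integral_sub_sq_mul t y (posteriorMoment P 1 t y)
  have h1 : 0 ≤ ∫ u, (u - posteriorMoment P 1 t y) ^ 2 * gaussDensity t (u, y) ∂P :=
    integral_nonneg fun u => mul_nonneg (sq_nonneg _) (gaussDensity_pos _ _).le
  have e1 : tiltedMoment P 1 t y = posteriorMoment P 1 t y * tiltedMoment P 0 t y :=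
    (div_mul_cancel₀ _ h0.ne').symm
  have e2 : tiltedMoment P 2 t y = posteriorMoment P 2 t y * tiltedMoment P 0 t y :=
    (div_mul_cancel₀ _ h0.ne').symm
  rw [h, e1, e2] at h1
  by_contra hlt
  push Not at hlt
  nlinarith [mul_pos (sub_pos.2 hlt) h0]

/-! ### Moments of the input, the output and the estimator -/

/-- The joint law of the symbol and the noise of the scalar channel. -/
noncomputable abbrev scalarLaw (P : Measure ℝ) : Measure (ℝ × ℝ) := P.prod (gaussianReal 0 1)

/-- The power of the conditional mean estimator of the symbol at amplitude `t`. -/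
noncomputable def estimatorPower (P : Measure ℝ) (t : ℝ) : ℝ :=
  ∫ ω, posteriorMoment P 1 t (t * ω.1 + ω.2) ^ 2 ∂(scalarLaw P)

lemma IsStandardized.integrable_fst_sq (hP : IsStandardized P) :
    Integrable (fun ω : ℝ × ℝ => ω.1 ^ 2) (scalarLaw P) := hP.integrable_sq.comp_fst _

lemma integrable_snd_sq : Integrable (fun ω : ℝ × ℝ => ω.2 ^ 2) (scalarLaw P) :=
  integrable_sq_gaussianReal.comp_snd _

lemma IsStandardized.integral_fst_sq (hP : IsStandardized P) :
    ∫ ω : ℝ × ℝ, ω.1 ^ 2 ∂(scalarLaw P) = 1 := by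
  rw [integral_fun_fst (μ := P) (ν := gaussianReal 0 1) (fun x => x ^ 2)]; simp [hP.power]

lemma integral_snd_sq : ∫ ω : ℝ × ℝ, ω.2 ^ 2 ∂(scalarLaw P) = 1 := by
  rw [integral_fun_snd (μ := P) (ν := gaussianReal 0 1) (fun x => x ^ 2)]
  simp [integral_sq_gaussianReal]

lemma IsStandardized.integrable_fst_mul_snd (hP : IsStandardized P) :
    Integrable (fun ω : ℝ × ℝ => ω.1 * ω.2) (scalarLaw P) :=
  hP.integrable_id.mul_prod ((memLp_id_gaussianReal 1).integrable le_rfl)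

lemma IsStandardized.integral_fst_mul_snd (hP : IsStandardized P) :
    ∫ ω : ℝ × ℝ, ω.1 * ω.2 ∂(scalarLaw P) = 0 := by
  rw [integral_prod_mul (fun x : ℝ => x) (fun x : ℝ => x), hP.mean, zero_mul]

lemma IsStandardized.integrable_output_sq (hP : IsStandardized P) (t : ℝ) :
    Integrable (fun ω : ℝ × ℝ => (t * ω.1 + ω.2) ^ 2) (scalarLaw P) := by
  refine (((hP.integrable_fst_sq.const_mul (t ^ 2)).add
    (hP.integrable_fst_mul_snd.const_mul (2 * t))).add (integrable_snd_sq (P := P))).congr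
    (ae_of_all _ fun ω => ?_)
  simp only [Pi.add_apply]; ring

lemma IsStandardized.integral_output_sq (hP : IsStandardized P) (t : ℝ) :
    ∫ ω : ℝ × ℝ, (t * ω.1 + ω.2) ^ 2 ∂(scalarLaw P) = t ^ 2 + 1 := by
  have h : ∀ ω : ℝ × ℝ, (t * ω.1 + ω.2) ^ 2 =
      t ^ 2 * ω.1 ^ 2 + 2 * t * (ω.1 * ω.2) + ω.2 ^ 2 := fun ω => by ring
  simp only [h]
  rw [integral_add _ integrable_snd_sq, integral_add (hP.integrable_fst_sq.const_mul _)
    (hP.integrable_fst_mul_snd.const_mul _), integral_const_mul, integral_const_mul,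
    hP.integral_fst_sq, hP.integral_fst_mul_snd, integral_snd_sq]
  · ring
  · exact (hP.integrable_fst_sq.const_mul _).add (hP.integrable_fst_mul_snd.const_mul _)

lemma IsStandardized.integrable_output_mul_fst (hP : IsStandardized P) (t : ℝ) :
    Integrable (fun ω : ℝ × ℝ => (t * ω.1 + ω.2) * ω.1) (scalarLaw P) := by
  refine ((hP.integrable_fst_sq.const_mul t).add hP.integrable_fst_mul_snd).congr
    (ae_of_all _ fun ω => ?_)
  simp only [Pi.add_apply]; ring

lemma IsStandardized.integral_output_mul_fst (hP : IsStandardized P) (t : ℝ) :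
    ∫ ω : ℝ × ℝ, (t * ω.1 + ω.2) * ω.1 ∂(scalarLaw P) = t := by
  have h : ∀ ω : ℝ × ℝ, (t * ω.1 + ω.2) * ω.1 = t * ω.1 ^ 2 + ω.1 * ω.2 := fun ω => by ring
  simp only [h]
  rw [integral_add (hP.integrable_fst_sq.const_mul _) hP.integrable_fst_mul_snd,
    integral_const_mul, hP.integral_fst_sq, hP.integral_fst_mul_snd]
  ring

lemma IsStandardized.continuous_posteriorMoment_output (hP : IsStandardized P) {j : ℕ}
    (hj : j ≤ 2) :
    Continuous fun q : ℝ × ℝ × ℝ => posteriorMoment P j q.1 (q.1 * q.2.1 + q.2.2) :=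
  (hP.continuous_posteriorMoment hj).comp
    (f := fun q : ℝ × ℝ × ℝ => (q.1, q.1 * q.2.1 + q.2.2)) (by fun_prop)

lemma IsStandardized.measurable_posteriorMoment_output (hP : IsStandardized P) {j : ℕ}
    (hj : j ≤ 2) (t : ℝ) :
    Measurable fun ω : ℝ × ℝ => posteriorMoment P j t (t * ω.1 + ω.2) :=
  ((hP.continuous_posteriorMoment_output hj).comp
    (f := fun ω : ℝ × ℝ => (t, ω)) (by fun_prop)).measurable

lemma IsStandardized.measurable_posteriorMoment (hP : IsStandardized P) {j : ℕ}
    (hj : j ≤ 2) (t : ℝ) : Measurable (posteriorMoment P j t) :=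
  ((hP.continuous_posteriorMoment hj).comp (f := fun y : ℝ => (t, y)) (by fun_prop)).measurable

lemma IsStandardized.integrable_posteriorMoment_output (hP : IsStandardized P) {j : ℕ}
    (hj : j ≤ 2) (t : ℝ) :
    Integrable (fun ω : ℝ × ℝ => posteriorMoment P j t (t * ω.1 + ω.2)) (scalarLaw P) := by
  have h := (hasTransitionDensity_gauss hP t).integrable_posteriorMean
    (f := fun u => u ^ j) (by fun_prop) (hP.integrable_pow hj)
  simpa only [posteriorMean_gauss] using h

lemma IsStandardized.integral_posteriorMoment_output (hP : IsStandardized P) {j : ℕ}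
    (hj : j ≤ 2) (t : ℝ) :
    ∫ ω : ℝ × ℝ, posteriorMoment P j t (t * ω.1 + ω.2) ∂(scalarLaw P) = ∫ u, u ^ j ∂P := by
  have h := (hasTransitionDensity_gauss hP t).integral_mul_posteriorMean
    (f := fun u => u ^ j) (g := fun _ => 1) (by fun_prop) (hP.integrable_pow hj) (by fun_prop)
    (by simpa using (hP.integrable_pow hj).comp_fst _)
  simp only [posteriorMean_gauss, one_mul] at h
  rw [h, integral_fun_fst (μ := P) (ν := gaussianReal 0 1) (fun x => x ^ j)]; simp

lemma IsStandardized.integrable_estimator_sq (hP : IsStandardized P) (t : ℝ) :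
    Integrable (fun ω : ℝ × ℝ => posteriorMoment P 1 t (t * ω.1 + ω.2) ^ 2) (scalarLaw P) :=
  (hP.integrable_posteriorMoment_output le_rfl t).mono'
    ((hP.measurable_posteriorMoment_output one_le_two t).pow_const 2).aestronglyMeasurable
    (ae_of_all _ fun ω => by
      rw [Real.norm_of_nonneg (sq_nonneg _)]; exact hP.posteriorMoment_one_sq_le _ _)

lemma IsStandardized.integrable_estimator_mul_fst (hP : IsStandardized P) (t : ℝ) :
    Integrable (fun ω : ℝ × ℝ => posteriorMoment P 1 t (t * ω.1 + ω.2) * ω.1) (scalarLaw P) := by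
  refine ((hP.integrable_estimator_sq t).add hP.integrable_fst_sq).mono'
    ((hP.measurable_posteriorMoment_output one_le_two t).mul measurable_fst).aestronglyMeasurable
    (ae_of_all _ fun ω => ?_)
  simp only [Pi.add_apply]
  rw [Real.norm_eq_abs, abs_le]
  constructor <;> nlinarith [sq_nonneg (posteriorMoment P 1 t (t * ω.1 + ω.2) - ω.1),
    sq_nonneg (posteriorMoment P 1 t (t * ω.1 + ω.2) + ω.1)]

lemma IsStandardized.integrable_output_mul_estimator (hP : IsStandardized P) (t : ℝ) :
    Integrable (fun ω : ℝ × ℝ => (t * ω.1 + ω.2) * posteriorMoment P 1 t (t * ω.1 + ω.2))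
      (scalarLaw P) := by
  refine ((hP.integrable_estimator_sq t).add (hP.integrable_output_sq t)).mono'
    (Measurable.mul (by fun_prop)
      (hP.measurable_posteriorMoment_output one_le_two t)).aestronglyMeasurable
    (ae_of_all _ fun ω => ?_)
  simp only [Pi.add_apply]
  rw [Real.norm_eq_abs, abs_le]
  constructor <;> nlinarith [sq_nonneg (posteriorMoment P 1 t (t * ω.1 + ω.2) - (t * ω.1 + ω.2)),
    sq_nonneg (posteriorMoment P 1 t (t * ω.1 + ω.2) + (t * ω.1 + ω.2))]

lemma IsStandardized.integral_estimator_mul_fst (hP : IsStandardized P) (t : ℝ) :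
    ∫ ω : ℝ × ℝ, posteriorMoment P 1 t (t * ω.1 + ω.2) * ω.1 ∂(scalarLaw P) =
      estimatorPower P t := by
  have h := (hasTransitionDensity_gauss hP t).integral_mul_posteriorMean
    (f := fun u => u ^ 1) (g := posteriorMoment P 1 t) (by fun_prop) (hP.integrable_pow one_le_two)
    (hP.measurable_posteriorMoment one_le_two t)
    (by simpa using hP.integrable_estimator_mul_fst t)
  simp only [posteriorMean_gauss_id, pow_one] at h
  rw [← h, estimatorPower]
  simp only [sq]

lemma IsStandardized.integral_output_mul_estimator (hP : IsStandardized P) (t : ℝ) :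
    ∫ ω : ℝ × ℝ, (t * ω.1 + ω.2) * posteriorMoment P 1 t (t * ω.1 + ω.2) ∂(scalarLaw P) = t := by
  have h := (hasTransitionDensity_gauss hP t).integral_mul_posteriorMean
    (f := fun u => u ^ 1) (g := fun y => y) (by fun_prop) (hP.integrable_pow one_le_two)
    (by fun_prop) (by simpa using hP.integrable_output_mul_fst t)
  simp only [posteriorMean_gauss_id, pow_one] at h
  rw [h, hP.integral_output_mul_fst]

/-- The error of the conditional mean is orthogonal to the estimator. -/
lemma IsStandardized.integral_error_sq (hP : IsStandardized P) (t : ℝ) :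
    ∫ ω : ℝ × ℝ, (ω.1 - posteriorMoment P 1 t (t * ω.1 + ω.2)) ^ 2 ∂(scalarLaw P) =
      1 - estimatorPower P t := by
  have h : ∀ ω : ℝ × ℝ, (ω.1 - posteriorMoment P 1 t (t * ω.1 + ω.2)) ^ 2 =
      ω.1 ^ 2 - 2 * (posteriorMoment P 1 t (t * ω.1 + ω.2) * ω.1)
        + posteriorMoment P 1 t (t * ω.1 + ω.2) ^ 2 := fun ω => by ring
  simp only [h]
  rw [integral_add _ (hP.integrable_estimator_sq t), integral_sub hP.integrable_fst_sq
    ((hP.integrable_estimator_mul_fst t).const_mul _), integral_const_mul, hP.integral_fst_sq,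
    hP.integral_estimator_mul_fst]
  · rw [estimatorPower]; ring
  · exact hP.integrable_fst_sq.sub ((hP.integrable_estimator_mul_fst t).const_mul _)

lemma IsStandardized.mmse_eq (hP : IsStandardized P) (s : ℝ) :
    mmse P s = 1 - estimatorPower P (√s) := by
  have h := (hasTransitionDensity_gauss hP √s).condMean_ae_eq (f := fun u => u ^ 1)
    (by fun_prop) (hP.integrable_pow one_le_two)
  simp only [posteriorMean_gauss_id, pow_one] at h
  rw [← hP.integral_error_sq, mmse]
  refine integral_congr_ae ?_
  filter_upwards [h] with ω hω
  rw [← hω]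

end ScalarChannel

/-! ### Continuity and strict monotonicity of the minimum mean-square error -/

section MMSE

/-- Dominated convergence with dominating functions `g i` that vary, but whose integrals
converge to the integral of their limit. -/
lemma tendsto_integral_of_le_of_tendsto {α ι : Type*} [MeasurableSpace α] {μ : Measure α}
    {l : Filter ι} [l.IsCountablyGenerated] {f g : ι → α → ℝ} {f₀ g₀ : α → ℝ}
    (hf0 : ∀ i a, 0 ≤ f i a) (hfg : ∀ i a, f i a ≤ g i a)
    (hf : ∀ i, Integrable (f i) μ) (hg : ∀ i, Integrable (g i) μ) (hg₀ : Integrable g₀ μ)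
    (h0 : ∀ a, f₀ a ≤ g₀ a)
    (hlf : ∀ a, Filter.Tendsto (fun i => f i a) l (nhds (f₀ a)))
    (hlg : ∀ a, Filter.Tendsto (fun i => g i a) l (nhds (g₀ a)))
    (hint : Filter.Tendsto (fun i => ∫ a, g i a ∂μ) l (nhds (∫ a, g₀ a ∂μ))) :
    Filter.Tendsto (fun i => ∫ a, f i a ∂μ) l (nhds (∫ a, f₀ a ∂μ)) := by
  -- The truncations `min (f i) g₀` and `min (g i) g₀` are dominated by `g₀`.
  have trunc : ∀ {u : ι → α → ℝ} {u₀ : α → ℝ}, (∀ i, Integrable (u i) μ) → (∀ i a, 0 ≤ u i a) →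
      (∀ a, u₀ a ≤ g₀ a) → (∀ a, Filter.Tendsto (fun i => u i a) l (nhds (u₀ a))) →
      Filter.Tendsto (fun i => ∫ a, min (u i a) (g₀ a) ∂μ) l (nhds (∫ a, u₀ a ∂μ)) := by
    intro u u₀ hu hu0 hug hl
    refine tendsto_integral_filter_of_dominated_convergence (fun a => ‖g₀ a‖)
      (Filter.Eventually.of_forall fun i => ((hu i).inf hg₀).aestronglyMeasurable)
      (Filter.Eventually.of_forall fun i => ae_of_all _ fun a => ?_) hg₀.norm
      (ae_of_all _ fun a => ?_)
    · rw [Real.norm_eq_abs, Real.norm_eq_abs, abs_le]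
      refine ⟨le_min (by linarith [hu0 i a, abs_nonneg (g₀ a)]) (neg_abs_le _), ?_⟩
      exact (min_le_right _ _).trans (le_abs_self _)
    · have := (hl a).min (tendsto_const_nhds (x := g₀ a))
      rwa [min_eq_left (hug a)] at this
  have hmin : ∀ {u : ι → α → ℝ}, (∀ i, Integrable (u i) μ) → ∀ i,
      Integrable (fun a => min (u i a) (g₀ a)) μ := fun hu i => (hu i).inf hg₀
  have t1 := trunc hf hf0 h0 hlf
  have t2 := trunc hg (fun i a => (hf0 i a).trans (hfg i a)) (fun a => le_rfl) hlg
  have t3 := hint.sub t2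
  rw [sub_self] at t3
  have t4 : Filter.Tendsto (fun i => ∫ a, f i a ∂μ - ∫ a, min (f i a) (g₀ a) ∂μ) l (nhds 0) := by
    refine squeeze_zero (fun i => ?_) (fun i => ?_) t3
    · exact sub_nonneg.2 (integral_mono (hmin hf i) (hf i) fun a => min_le_left _ _)
    · rw [← integral_sub (hf i) (hmin hf i), ← integral_sub (hg i) (hmin hg i)]
      refine integral_mono ((hf i).sub (hmin hf i)) ((hg i).sub (hmin hg i)) fun a => ?_
      have := hfg i a
      simp only
      rcases le_total (f i a) (g₀ a) with h1 | h1 <;>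
        rcases le_total (g i a) (g₀ a) with h2 | h2 <;>
        simp only [h1, h2, min_eq_left, min_eq_right] <;> linarith
  simpa using t4.add t1

variable {P : Measure ℝ} [IsProbabilityMeasure P]

lemma IsStandardized.continuous_estimatorPower (hP : IsStandardized P) :
    Continuous (estimatorPower P) := by
  have hc : ∀ {j : ℕ}, j ≤ 2 → ∀ ω : ℝ × ℝ,
      Continuous fun t => posteriorMoment P j t (t * ω.1 + ω.2) := fun hj ω =>
    (hP.continuous_posteriorMoment_output hj).comp (f := fun t : ℝ => (t, ω)) (by fun_prop)
  refine continuous_iff_continuousAt.2 fun t => ?_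
  exact tendsto_integral_of_le_of_tendsto (μ := scalarLaw P) (l := nhds t)
    (f := fun t ω => posteriorMoment P 1 t (t * ω.1 + ω.2) ^ 2)
    (g := fun t ω => posteriorMoment P 2 t (t * ω.1 + ω.2))
    (f₀ := fun ω => posteriorMoment P 1 t (t * ω.1 + ω.2) ^ 2)
    (g₀ := fun ω => posteriorMoment P 2 t (t * ω.1 + ω.2))
    (fun _ _ => sq_nonneg _) (fun t ω => hP.posteriorMoment_one_sq_le _ _)
    hP.integrable_estimator_sq (hP.integrable_posteriorMoment_output le_rfl)
    (hP.integrable_posteriorMoment_output le_rfl t)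
    (fun ω => hP.posteriorMoment_one_sq_le _ _)
    (fun ω => ((hc one_le_two ω).pow 2).continuousAt) (fun ω => (hc le_rfl ω).continuousAt)
    (by simp only [hP.integral_posteriorMoment_output le_rfl]; exact tendsto_const_nhds)

/-- Comparison with the best linear estimator. -/
lemma IsStandardized.le_estimatorPower (hP : IsStandardized P) (t : ℝ) :
    t ^ 2 / (1 + t ^ 2) ≤ estimatorPower P t := by
  set c := t / (1 + t ^ 2)
  have h0 : 0 ≤ ∫ ω : ℝ × ℝ, (posteriorMoment P 1 t (t * ω.1 + ω.2) -
      c * (t * ω.1 + ω.2)) ^ 2 ∂(scalarLaw P) := integral_nonneg fun _ => sq_nonneg _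
  have h : ∀ ω : ℝ × ℝ, (posteriorMoment P 1 t (t * ω.1 + ω.2) - c * (t * ω.1 + ω.2)) ^ 2 =
      posteriorMoment P 1 t (t * ω.1 + ω.2) ^ 2
        - 2 * c * ((t * ω.1 + ω.2) * posteriorMoment P 1 t (t * ω.1 + ω.2))
        + c ^ 2 * (t * ω.1 + ω.2) ^ 2 := fun ω => by ring
  simp only [h] at h0
  rw [integral_add _ ((hP.integrable_output_sq t).const_mul _),
    integral_sub (hP.integrable_estimator_sq t)
    ((hP.integrable_output_mul_estimator t).const_mul _), integral_const_mul, integral_const_mul,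
    hP.integral_output_sq, hP.integral_output_mul_estimator] at h0
  · change 0 ≤ estimatorPower P t - _ + _ at h0
    have h1 : (0 : ℝ) < 1 + t ^ 2 := by positivity
    have e : 2 * c * t - c ^ 2 * (t ^ 2 + 1) = t ^ 2 / (1 + t ^ 2) := by
      simp only [c]; field_simp; ring
    linarith
  · exact (hP.integrable_estimator_sq t).sub ((hP.integrable_output_mul_estimator t).const_mul _)

lemma IsStandardized.estimatorPower_zero (hP : IsStandardized P) : estimatorPower P 0 = 0 := by
  simp [estimatorPower, posteriorMoment, tiltedMoment, gaussDensity, hP.mean]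

/-- A nonconstant symbol has a nonconstant conditional mean. -/
lemma IsStandardized.posteriorMoment_one_not_const (hP : IsStandardized P) {t : ℝ} (ht : 0 < t)
    (c : ℝ) : ∃ y, posteriorMoment P 1 t y ≠ c := by
  by_contra! hc
  have hint : ∀ y, Integrable (fun u => (u - c) * gaussDensity t (u, y)) P := fun y => by
    refine ((hP.integrable_tilted one_le_two t y).sub
      ((hP.integrable_tilted (Nat.zero_le 2) t y).const_mul c)).congr (ae_of_all _ fun u => ?_)
    simp only [Pi.sub_apply]; ring
  have h0 : ∀ y, ∫ u, (u - c) * gaussDensity t (u, y) ∂P = 0 := fun y => by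
    have e : ∀ u, (u - c) * gaussDensity t (u, y) =
      u ^ 1 * gaussDensity t (u, y) - c * (u ^ 0 * gaussDensity t (u, y)) := fun u => by ring
    simp only [e]
    rw [integral_sub (hP.integrable_tilted one_le_two t y)
      ((hP.integrable_tilted (Nat.zero_le 2) t y).const_mul c), integral_const_mul]
    change tiltedMoment P 1 t y - c * tiltedMoment P 0 t y = 0
    rw [← hc y, posteriorMoment, div_mul_cancel₀ _ (hP.tiltedMoment_zero_pos t y).ne', sub_self]
  -- Moving the observation from `0` to `1` multiplies the density by `exp (t * u)`.
  have e1 : ∀ u, gaussDensity t (u, 1) = Real.exp (t * u) * gaussDensity t (u, 0) := fun u => by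
    rw [gaussDensity, gaussDensity, ← Real.exp_add]; congr 1; ring
  have e2 : ∀ u, (u - c) * (Real.exp (t * u) - Real.exp (t * c)) * gaussDensity t (u, 0) =
      (u - c) * gaussDensity t (u, 1) - Real.exp (t * c) * ((u - c) * gaussDensity t (u, 0)) :=
    fun u => by rw [e1]; ring
  have hnn : ∀ u, 0 ≤ (u - c) * (Real.exp (t * u) - Real.exp (t * c)) * gaussDensity t (u, 0) :=
    fun u => mul_nonneg (by
      rcases le_total c u with h | h
      · exact mul_nonneg (sub_nonneg.2 h)
          (sub_nonneg.2 (Real.exp_le_exp.2 (mul_le_mul_of_nonneg_left h ht.le)))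
      · exact mul_nonneg_of_nonpos_of_nonpos (sub_nonpos.2 h)
          (sub_nonpos.2 (Real.exp_le_exp.2 (mul_le_mul_of_nonneg_left h ht.le))))
      (gaussDensity_pos _ _).le
  have hz : ∫ u, (u - c) * (Real.exp (t * u) - Real.exp (t * c)) * gaussDensity t (u, 0) ∂P
      = 0 := by
    simp only [e2]
    rw [integral_sub (hint 1) ((hint 0).const_mul _), integral_const_mul, h0, h0]; simp
  have hi : Integrable
      (fun u => (u - c) * (Real.exp (t * u) - Real.exp (t * c)) * gaussDensity t (u, 0)) P := by
    simp only [e2]; exact (hint 1).sub ((hint 0).const_mul _)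
  have hae : ∀ᵐ u ∂P, u = c := by
    filter_upwards [(integral_eq_zero_iff_of_nonneg hnn hi).1 hz] with u hu
    rcases mul_eq_zero.1 hu with h | h
    · rcases mul_eq_zero.1 h with h | h
      · linarith
      · exact mul_left_cancel₀ ht.ne' (Real.exp_injective (sub_eq_zero.1 h))
    · exact absurd h (gaussDensity_pos _ _).ne'
  have m1 : ∫ u, u ∂P = c := by
    rw [integral_congr_ae (g := fun _ => c) (by filter_upwards [hae] with u hu using hu)]; simp
  have m2 : ∫ u, u ^ 2 ∂P = c ^ 2 := by
    rw [integral_congr_ae (g := fun _ => c ^ 2) (by filter_upwards [hae] with u hu; rw [hu])]; simp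
  rw [hP.mean] at m1
  rw [hP.power, ← m1] at m2
  norm_num at m2

/-! ### Degradation of the Gaussian channel -/

lemma gaussianReal_prod_map_rotation {a b : ℝ} (hab : a ^ 2 + b ^ 2 = 1) :
    ((gaussianReal 0 1).prod (gaussianReal 0 1)).map (fun q : ℝ × ℝ => a * q.1 + b * q.2) =
      gaussianReal 0 1 := by
  have h1 : (fun q : ℝ × ℝ => a * q.1 + b * q.2) =
    (fun q : ℝ × ℝ => q.1 + q.2) ∘ Prod.map (fun x => a * x) (fun x => b * x) := rfl
  rw [h1, ← Measure.map_map (by fun_prop) (by fun_prop),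
    ← Measure.map_prod_map _ _ (by fun_prop) (by fun_prop),
    gaussianReal_map_const_mul, gaussianReal_map_const_mul]
  change Measure.conv _ _ = _
  rw [gaussianReal_conv_gaussianReal]
  congr 1
  · simp
  · ext; simpa using hab

lemma integrable_gaussDensity_mix (t u y : ℝ) (a b : ℝ) :
    Integrable (fun z => gaussDensity t (u, a * y + b * z)) (gaussianReal 0 1) := by
  refine ((integrable_exp_mul_gaussianReal (t * u * b)).const_mul
    (Real.exp (t * u * (a * y) - t ^ 2 * u ^ 2 / 2))).congr (ae_of_all _ fun z => ?_)
  simp only [gaussDensity]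
  rw [← Real.exp_add]; congr 1; ring

lemma integral_gaussDensity_mix {a b : ℝ} (hab : a ^ 2 + b ^ 2 = 1) (t u y : ℝ) :
    ∫ z, gaussDensity t (u, a * y + b * z) ∂(gaussianReal 0 1) = gaussDensity (a * t) (u, y) := by
  have h := mgf_gaussianReal (p := gaussianReal 0 1) (X := fun z : ℝ => z) (μ := 0) (v := 1)
    (by simp) (t * u * b)
  rw [mgf] at h
  have e : ∀ z, gaussDensity t (u, a * y + b * z) =
      Real.exp (t * u * (a * y) - t ^ 2 * u ^ 2 / 2) * Real.exp (t * u * b * z) := fun z => by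
    rw [gaussDensity, ← Real.exp_add]; congr 1; ring
  simp only [e]
  rw [integral_const_mul, h, gaussDensity, ← Real.exp_add]
  congr 1
  simp only [NNReal.coe_one]
  linear_combination (t ^ 2 * u ^ 2 / 2) * hab

lemma IsStandardized.integrable_pow_mul_gaussDensity_mix (hP : IsStandardized P) {j : ℕ}
    (hj : j ≤ 2) {a b : ℝ} (hab : a ^ 2 + b ^ 2 = 1) (t y : ℝ) :
    Integrable (fun q : ℝ × ℝ => q.1 ^ j * gaussDensity t (q.1, a * y + b * q.2))
      (P.prod (gaussianReal 0 1)) := by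
  refine (integrable_prod_iff (Measurable.aestronglyMeasurable
    (by unfold gaussDensity; fun_prop))).2 ⟨ae_of_all _ fun u => ?_, ?_⟩
  · exact (integrable_gaussDensity_mix t u y a b).const_mul (u ^ j)
  · refine (hP.integrable_tilted hj (a * t) y).norm.congr (ae_of_all _ fun u => ?_)
    simp only [norm_mul, Real.norm_of_nonneg (gaussDensity_pos _ _).le]
    rw [integral_const_mul, integral_gaussDensity_mix hab]

lemma IsStandardized.integrable_tiltedMoment_mix (hP : IsStandardized P) {j : ℕ}
    (hj : j ≤ 2) {a b : ℝ} (hab : a ^ 2 + b ^ 2 = 1) (t y : ℝ) :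
    Integrable (fun z => tiltedMoment P j t (a * y + b * z)) (gaussianReal 0 1) :=
  (hP.integrable_pow_mul_gaussDensity_mix hj hab t y).integral_prod_right

/-- The Gaussian channel of amplitude `a * t` is a degraded version of the one of amplitude `t`. -/
lemma IsStandardized.integral_tiltedMoment_mix (hP : IsStandardized P) {j : ℕ}
    (hj : j ≤ 2) {a b : ℝ} (hab : a ^ 2 + b ^ 2 = 1) (t y : ℝ) :
    ∫ z, tiltedMoment P j t (a * y + b * z) ∂(gaussianReal 0 1) = tiltedMoment P j (a * t) y := by
  have h := hP.integrable_pow_mul_gaussDensity_mix hj hab t y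
  have e := (integral_prod_symm _ h).symm.trans (integral_prod _ h)
  refine e.trans ?_
  refine integral_congr_ae (ae_of_all _ fun u => ?_)
  simp only
  rw [integral_const_mul, integral_gaussDensity_mix hab]

lemma IsStandardized.integrable_sq_mul_tiltedMoment (hP : IsStandardized P) (t : ℝ) :
    Integrable (fun y => tiltedMoment P 0 t y * posteriorMoment P 1 t y ^ 2)
      (gaussianReal 0 1) := by
  have hm : Measurable fun p : ℝ × ℝ => posteriorMoment P 1 t p.2 ^ 2 :=
    ((hP.measurable_posteriorMoment one_le_two t).comp measurable_snd).pow_const 2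
  have h := ((hasTransitionDensity_gauss hP t).integrable_comp_iff hm).1
    (hP.integrable_estimator_sq t)
  refine h.integral_prod_right.congr (ae_of_all _ fun y => ?_)
  simp only
  rw [integral_mul_const, tiltedMoment]
  simp

lemma IsStandardized.integral_sq_mul_tiltedMoment (hP : IsStandardized P) (t : ℝ) :
    ∫ y, tiltedMoment P 0 t y * posteriorMoment P 1 t y ^ 2 ∂(gaussianReal 0 1) =
      estimatorPower P t := by
  have hm : Measurable fun p : ℝ × ℝ => posteriorMoment P 1 t p.2 ^ 2 :=
    ((hP.measurable_posteriorMoment one_le_two t).comp measurable_snd).pow_const 2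
  have h := ((hasTransitionDensity_gauss hP t).integrable_comp_iff hm).1
    (hP.integrable_estimator_sq t)
  refine Eq.trans ?_ ((hasTransitionDensity_gauss hP t).integral_comp hm).symm
  rw [integral_prod_symm _ h]
  refine integral_congr_ae (ae_of_all _ fun y => ?_)
  simp only
  rw [integral_mul_const, tiltedMoment]
  simp

lemma IsStandardized.tiltedMoment_one_eq (hP : IsStandardized P) (t y : ℝ) :
    tiltedMoment P 1 t y = tiltedMoment P 0 t y * posteriorMoment P 1 t y :=
  (mul_div_cancel₀ _ (hP.tiltedMoment_zero_pos t y).ne').symm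

/-- The power lost by the estimator under degradation is the mean-square distance between the
estimators before and after it. -/
lemma IsStandardized.integral_estimator_sub_sq (hP : IsStandardized P) {a b : ℝ}
    (hab : a ^ 2 + b ^ 2 = 1) (t : ℝ) :
    Integrable (fun q : ℝ × ℝ => tiltedMoment P 0 t (a * q.1 + b * q.2) *
      (posteriorMoment P 1 t (a * q.1 + b * q.2) - posteriorMoment P 1 (a * t) q.1) ^ 2)
      ((gaussianReal 0 1).prod (gaussianReal 0 1)) ∧
    ∫ q : ℝ × ℝ, tiltedMoment P 0 t (a * q.1 + b * q.2) *
      (posteriorMoment P 1 t (a * q.1 + b * q.2) - posteriorMoment P 1 (a * t) q.1) ^ 2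
      ∂((gaussianReal 0 1).prod (gaussianReal 0 1)) =
    estimatorPower P t - estimatorPower P (a * t) := by
  set γ := gaussianReal 0 1
  have hT : ∀ {j : ℕ}, j ≤ 2 → Continuous fun y => tiltedMoment P j t y := fun hj =>
    (hP.continuous_tiltedMoment hj).comp (f := fun y : ℝ => (t, y)) (by fun_prop)
  have hM : ∀ s, Continuous fun y => posteriorMoment P 1 s y := fun s =>
    (hP.continuous_posteriorMoment one_le_two).comp (f := fun y : ℝ => (s, y)) (by fun_prop)
  have cw : Continuous fun q : ℝ × ℝ => a * q.1 + b * q.2 := by fun_prop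
  have mp : MeasurePreserving (fun q : ℝ × ℝ => a * q.1 + b * q.2) (γ.prod γ) γ :=
    ⟨cw.measurable, gaussianReal_prod_map_rotation hab⟩
  -- The three terms of the expanded square.
  have i1 : Integrable (fun q : ℝ × ℝ => tiltedMoment P 0 t (a * q.1 + b * q.2) *
      posteriorMoment P 1 t (a * q.1 + b * q.2) ^ 2) (γ.prod γ) :=
    mp.integrable_comp_of_integrable (hP.integrable_sq_mul_tiltedMoment t)
  have v1 : ∫ q : ℝ × ℝ, tiltedMoment P 0 t (a * q.1 + b * q.2) *
      posteriorMoment P 1 t (a * q.1 + b * q.2) ^ 2 ∂(γ.prod γ) = estimatorPower P t := by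
    have h := integral_map (μ := γ.prod γ) cw.aemeasurable
      (f := fun y => tiltedMoment P 0 t y * posteriorMoment P 1 t y ^ 2)
      ((hT (Nat.zero_le 2)).mul ((hM t).pow 2)).aestronglyMeasurable
    rw [mp.map_eq, hP.integral_sq_mul_tiltedMoment t] at h
    exact h.symm
  have i2 : Integrable (fun q : ℝ × ℝ => tiltedMoment P 0 t (a * q.1 + b * q.2) *
      posteriorMoment P 1 (a * t) q.1 ^ 2) (γ.prod γ) := by
    have cc : Continuous fun q : ℝ × ℝ => tiltedMoment P 0 t (a * q.1 + b * q.2) *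
      posteriorMoment P 1 (a * t) q.1 ^ 2 :=
      ((hT (Nat.zero_le 2)).comp cw).mul (((hM (a * t)).comp continuous_fst).pow 2)
    refine (integrable_prod_iff cc.aestronglyMeasurable).2 ⟨ae_of_all _ fun y => ?_, ?_⟩
    · exact (hP.integrable_tiltedMoment_mix (Nat.zero_le 2) hab t y).mul_const
        (posteriorMoment P 1 (a * t) y ^ 2)
    · refine (hP.integrable_sq_mul_tiltedMoment (a * t)).congr (ae_of_all _ fun y => ?_)
      simp only [norm_mul, Real.norm_of_nonneg (hP.tiltedMoment_zero_pos _ _).le]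
      rw [integral_mul_const, hP.integral_tiltedMoment_mix (Nat.zero_le 2) hab,
        Real.norm_of_nonneg (sq_nonneg _)]
  have v2 : ∫ q : ℝ × ℝ, tiltedMoment P 0 t (a * q.1 + b * q.2) *
      posteriorMoment P 1 (a * t) q.1 ^ 2 ∂(γ.prod γ) = estimatorPower P (a * t) := by
    rw [integral_prod _ i2, ← hP.integral_sq_mul_tiltedMoment (a * t)]
    refine integral_congr_ae (ae_of_all _ fun y => ?_)
    simp only
    rw [integral_mul_const, hP.integral_tiltedMoment_mix (Nat.zero_le 2) hab]
  have i3 : Integrable (fun q : ℝ × ℝ => tiltedMoment P 1 t (a * q.1 + b * q.2) *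
      posteriorMoment P 1 (a * t) q.1) (γ.prod γ) := by
    have cc : Continuous fun q : ℝ × ℝ => tiltedMoment P 1 t (a * q.1 + b * q.2) *
      posteriorMoment P 1 (a * t) q.1 :=
      ((hT one_le_two).comp cw).mul ((hM (a * t)).comp continuous_fst)
    refine (i1.add i2).mono' cc.aestronglyMeasurable (ae_of_all _ fun q => ?_)
    have h0 := hP.tiltedMoment_zero_pos t (a * q.1 + b * q.2)
    simp only [Pi.add_apply]
    rw [hP.tiltedMoment_one_eq, mul_assoc, norm_mul, Real.norm_of_nonneg h0.le, ← mul_add]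
    refine mul_le_mul_of_nonneg_left ?_ h0.le
    rw [Real.norm_eq_abs, abs_le]
    constructor <;> nlinarith [sq_nonneg (posteriorMoment P 1 t (a * q.1 + b * q.2) -
      posteriorMoment P 1 (a * t) q.1), sq_nonneg (posteriorMoment P 1 t (a * q.1 + b * q.2) +
      posteriorMoment P 1 (a * t) q.1)]
  have v3 : ∫ q : ℝ × ℝ, tiltedMoment P 1 t (a * q.1 + b * q.2) *
      posteriorMoment P 1 (a * t) q.1 ∂(γ.prod γ) = estimatorPower P (a * t) := by
    rw [integral_prod _ i3, ← hP.integral_sq_mul_tiltedMoment (a * t)]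
    refine integral_congr_ae (ae_of_all _ fun y => ?_)
    simp only
    rw [integral_mul_const, hP.integral_tiltedMoment_mix one_le_two hab, hP.tiltedMoment_one_eq]
    ring
  have e : ∀ q : ℝ × ℝ, tiltedMoment P 0 t (a * q.1 + b * q.2) *
      (posteriorMoment P 1 t (a * q.1 + b * q.2) - posteriorMoment P 1 (a * t) q.1) ^ 2 =
      tiltedMoment P 0 t (a * q.1 + b * q.2) * posteriorMoment P 1 t (a * q.1 + b * q.2) ^ 2
      - 2 * (tiltedMoment P 1 t (a * q.1 + b * q.2) * posteriorMoment P 1 (a * t) q.1)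
      + tiltedMoment P 0 t (a * q.1 + b * q.2) * posteriorMoment P 1 (a * t) q.1 ^ 2 :=
    fun q => by rw [hP.tiltedMoment_one_eq]; ring
  simp only [e]
  refine ⟨(i1.sub (i3.const_mul 2)).add i2, ?_⟩
  rw [integral_add ?_ i2, integral_sub i1 (i3.const_mul 2), integral_const_mul, v1, v2, v3]
  · ring
  · exact i1.sub (i3.const_mul 2)

lemma IsStandardized.strictMonoOn_estimatorPower (hP : IsStandardized P) :
    StrictMonoOn (estimatorPower P) (Set.Ici 0) := by
  -- The amplitude `s < t` is `a * t` with `a < 1`; the rest of the noise has amplitude `b > 0`.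
  intro s hs t _ hst
  have hs0 : 0 ≤ s := hs
  have ht : 0 < t := hs0.trans_lt hst
  set a := s / t
  have ha0 : 0 ≤ a := div_nonneg hs0 ht.le
  have ha1 : a < 1 := (div_lt_one ht).2 hst
  have hpos : 0 < 1 - a ^ 2 := by nlinarith
  set b := √(1 - a ^ 2) with hb
  have hb0 : 0 < b := Real.sqrt_pos.2 hpos
  have hab : a ^ 2 + b ^ 2 = 1 := by rw [hb, Real.sq_sqrt hpos.le]; ring
  have hat : a * t = s := div_mul_cancel₀ _ ht.ne'
  obtain ⟨hi, hv⟩ := hP.integral_estimator_sub_sq hab t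
  rw [hat] at hi hv
  have hnn : ∀ q : ℝ × ℝ, 0 ≤ tiltedMoment P 0 t (a * q.1 + b * q.2) *
      (posteriorMoment P 1 t (a * q.1 + b * q.2) - posteriorMoment P 1 s q.1) ^ 2 :=
    fun q => mul_nonneg (hP.tiltedMoment_zero_pos _ _).le (sq_nonneg _)
  have h0 := integral_nonneg_of_ae (μ := (gaussianReal 0 1).prod (gaussianReal 0 1))
    (ae_of_all _ hnn)
  rw [hv] at h0
  refine lt_of_le_of_ne (sub_nonneg.1 h0) fun heq => ?_
  rw [heq, sub_self] at hv
  have hae := (integral_eq_zero_iff_of_nonneg hnn hi).1 hv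
  have hop : (gaussianReal 0 1).IsOpenPosMeasure :=
    (gaussianReal_absolutelyContinuous' 0 one_ne_zero).isOpenPosMeasure
  have cw : Continuous fun q : ℝ × ℝ => a * q.1 + b * q.2 := by fun_prop
  have hT : Continuous fun y => tiltedMoment P 0 t y :=
    (hP.continuous_tiltedMoment (Nat.zero_le 2)).comp (f := fun y : ℝ => (t, y)) (by fun_prop)
  have hM : ∀ s, Continuous fun y => posteriorMoment P 1 s y := fun s =>
    (hP.continuous_posteriorMoment one_le_two).comp (f := fun y : ℝ => (s, y)) (by fun_prop)
  -- The Gaussian law charges all open sets, so the estimators agree at all `a * y + b * z` and `y`.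
  have hall := (Continuous.ae_eq_iff_eq ((gaussianReal 0 1).prod (gaussianReal 0 1))
    ((hT.comp cw).mul ((((hM t).comp cw).sub ((hM s).comp continuous_fst)).pow 2))
    continuous_zero).1 hae
  obtain ⟨y, hy⟩ := hP.posteriorMoment_one_not_const ht (posteriorMoment P 1 s 0)
  have h := congrFun hall (0, y / b)
  simp only [Pi.mul_apply, Pi.pow_apply, Function.comp, Pi.zero_apply, Pi.sub_apply, mul_zero,
    zero_add, mul_div_cancel₀ _ hb0.ne'] at h
  rcases mul_eq_zero.1 h with h | h
  · exact (hP.tiltedMoment_zero_pos _ _).ne' h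
  · exact hy (sub_eq_zero.1 (pow_eq_zero_iff two_ne_zero |>.1 h))

/-- Continuity on the whole line: the MMSE is constant for negative arguments, where `√s = 0`. -/
lemma IsStandardized.continuous_mmse (hP : IsStandardized P) : Continuous (mmse P) := by
  have h : mmse P = fun s => 1 - estimatorPower P √s := funext hP.mmse_eq
  rw [h]
  exact continuous_const.sub (hP.continuous_estimatorPower.comp Real.continuous_sqrt)

lemma IsStandardized.strictAntiOn_mmse (hP : IsStandardized P) :
    StrictAntiOn (mmse P) (Set.Ici 0) := by
  intro s hs t _ hst
  rw [hP.mmse_eq, hP.mmse_eq]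
  have := hP.strictMonoOn_estimatorPower (Real.sqrt_nonneg s) (Real.sqrt_nonneg t)
    (Real.sqrt_lt_sqrt hs hst)
  linarith

lemma IsStandardized.mmse_zero (hP : IsStandardized P) : mmse P 0 = 1 := by
  rw [hP.mmse_eq, Real.sqrt_zero, hP.estimatorPower_zero, sub_zero]

lemma mmse_nonneg (P : Measure ℝ) (s : ℝ) : 0 ≤ mmse P s := integral_nonneg fun _ => sq_nonneg _

lemma IsStandardized.mmse_pos (hP : IsStandardized P) {s : ℝ} (hs : 0 ≤ s) : 0 < mmse P s :=
  (mmse_nonneg P (s + 1)).trans_lt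
    (hP.strictAntiOn_mmse hs (Set.mem_Ici.2 (by linarith)) (by linarith))

lemma IsStandardized.mmse_le_one (hP : IsStandardized P) {s : ℝ} (hs : 0 ≤ s) : mmse P s ≤ 1 := by
  rw [← hP.mmse_zero]
  exact hP.strictAntiOn_mmse.antitoneOn (Set.mem_Ici.2 le_rfl) hs hs

lemma IsStandardized.mmse_le (hP : IsStandardized P) {s : ℝ} (hs : 0 ≤ s) :
    mmse P s ≤ 1 / (1 + s) := by
  have h := hP.le_estimatorPower √s
  rw [Real.sq_sqrt hs] at h
  rw [hP.mmse_eq]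
  have : 1 / (1 + s) = 1 - s / (1 + s) := by field_simp; ring
  linarith

lemma IsStandardized.exists_mmse_eq (hP : IsStandardized P) {ψ : ℝ} (h0 : 0 < ψ) (h1 : ψ ≤ 1) :
    ∃ s, 0 ≤ s ∧ mmse P s = ψ := by
  have hb : mmse P (1 / ψ) ≤ ψ := by
    refine (hP.mmse_le (by positivity)).trans ?_
    rw [div_le_iff₀ (by positivity), mul_add, mul_one_div_cancel h0.ne']
    linarith
  obtain ⟨s, hs, hs'⟩ := intermediate_value_Icc' (show (0 : ℝ) ≤ 1 / ψ by positivity)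
    hP.continuous_mmse.continuousOn ⟨hb, by rw [hP.mmse_zero]; exact h1⟩
  exact ⟨s, hs.1, hs'⟩

lemma IsStandardized.mmseInv_mmse (hP : IsStandardized P) {s : ℝ} (hs : 0 ≤ s) :
    mmseInv P (mmse P s) = s := by
  have : {r : ℝ | 0 ≤ r ∧ mmse P r = mmse P s} = {s} := by
    ext r
    refine ⟨fun h => hP.strictAntiOn_mmse.injOn h.1 hs h.2, ?_⟩
    rintro rfl
    exact ⟨hs, rfl⟩
  rw [mmseInv, this, csInf_singleton]

lemma IsStandardized.mmse_eq_iff (hP : IsStandardized P) {s ψ : ℝ} (hs : 0 ≤ s) (h0 : 0 < ψ)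
    (h1 : ψ ≤ 1) : mmse P s = ψ ↔ s = mmseInv P ψ := by
  obtain ⟨r, hr, rfl⟩ := hP.exists_mmse_eq h0 h1
  rw [hP.mmseInv_mmse hr]
  exact (hP.strictAntiOn_mmse.eq_iff_eq hs hr).trans eq_comm

end MMSE

/-! ### Mutual information of the scalar Gaussian channel -/

section Information

set_option linter.unusedSectionVars false

variable {P : Measure ℝ} [IsProbabilityMeasure P]

/-- The mutual information of the scalar Gaussian channel of amplitude `t`, as the mean of the
logarithm of the likelihood ratio. -/
noncomputable def gaussInfo (P : Measure ℝ) (t : ℝ) : ℝ :=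
  ∫ ω, Real.log (gaussDensity t (ω.1, t * ω.1 + ω.2) / tiltedMoment P 0 t (t * ω.1 + ω.2))
    ∂(scalarLaw P)

lemma IsStandardized.tiltedMoment_zero_le (hP : IsStandardized P) (t y : ℝ) :
    tiltedMoment P 0 t y ≤ Real.exp (y ^ 2 / 2) := by
  have h := integral_mono (hP.integrable_tilted (Nat.zero_le 2) t y)
    (integrable_const (Real.exp (y ^ 2 / 2))) fun u => by simpa using gaussDensity_le t u y
  simpa [tiltedMoment] using h

/-- Jensen's inequality for the output density. -/
lemma IsStandardized.le_tiltedMoment_zero (hP : IsStandardized P) (t y : ℝ) :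
    Real.exp (-(t ^ 2 / 2)) ≤ tiltedMoment P 0 t y := by
  have i1 : Integrable (fun u : ℝ => t * y * u - t ^ 2 / 2 * u ^ 2) P :=
    (hP.integrable_id.const_mul _).sub (hP.integrable_sq.const_mul _)
  have i2 : Integrable (fun u : ℝ => t * y * u - t ^ 2 / 2 * u ^ 2 + t ^ 2 / 2) P :=
    i1.add (integrable_const _)
  have hi : Integrable (fun u : ℝ => 1 + (t * y * u - t ^ 2 / 2 * u ^ 2 + t ^ 2 / 2)) P :=
    (integrable_const _).add i2
  have h := integral_mono hi
    ((hP.integrable_tilted (Nat.zero_le 2) t y).mul_const (Real.exp (t ^ 2 / 2))) fun u => by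
      have := Real.add_one_le_exp (t * y * u - t ^ 2 / 2 * u ^ 2 + t ^ 2 / 2)
      simp only [pow_zero, one_mul, gaussDensity, ← Real.exp_add]
      refine (add_comm _ _).trans_le (this.trans_eq ?_)
      congr 1; ring
  rw [integral_mul_const, integral_add (integrable_const _) i2,
    integral_add i1 (integrable_const _),
    integral_sub (hP.integrable_id.const_mul _) (hP.integrable_sq.const_mul _),
    integral_const_mul, integral_const_mul, hP.mean, hP.power] at h
  simp only [integral_const, probReal_univ, smul_eq_mul] at h
  rw [Real.exp_neg, inv_le_iff_one_le_mul₀ (Real.exp_pos _)]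
  change _ ≤ tiltedMoment P 0 t y * _ at h
  linarith

/-- A quadratic bound, which makes the information finite without any assumption on the symbol
beyond its power. -/
lemma IsStandardized.abs_log_tiltedMoment_zero_le (hP : IsStandardized P) (t y : ℝ) :
    |Real.log (tiltedMoment P 0 t y)| ≤ y ^ 2 / 2 + t ^ 2 / 2 := by
  have h0 := hP.tiltedMoment_zero_pos t y
  have h1 := Real.log_le_log h0 (hP.tiltedMoment_zero_le t y)
  have h2 := Real.log_le_log (Real.exp_pos _) (hP.le_tiltedMoment_zero t y)
  rw [Real.log_exp] at h1 h2
  rw [abs_le]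
  constructor <;> nlinarith [sq_nonneg y, sq_nonneg t]

lemma IsStandardized.integrable_log_tiltedMoment_zero (hP : IsStandardized P) (t : ℝ) :
    Integrable (fun ω : ℝ × ℝ => Real.log (tiltedMoment P 0 t (t * ω.1 + ω.2)))
      (scalarLaw P) := by
  have hc : Continuous fun ω : ℝ × ℝ => tiltedMoment P 0 t (t * ω.1 + ω.2) :=
    (hP.continuous_tiltedMoment (Nat.zero_le 2)).comp
      (f := fun ω : ℝ × ℝ => (t, t * ω.1 + ω.2)) (by fun_prop)
  refine (((hP.integrable_output_sq t).div_const 2).add (integrable_const (t ^ 2 / 2))).mono'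
    (hc.log fun ω => (hP.tiltedMoment_zero_pos _ _).ne').aestronglyMeasurable
    (ae_of_all _ fun ω => ?_)
  exact hP.abs_log_tiltedMoment_zero_le _ _

lemma IsStandardized.log_likelihoodRatio (hP : IsStandardized P) (t x y : ℝ) :
    Real.log (gaussDensity t (x, y) / tiltedMoment P 0 t y) =
      t * (y * x) - t ^ 2 / 2 * x ^ 2 - Real.log (tiltedMoment P 0 t y) := by
  rw [Real.log_div (gaussDensity_pos _ _).ne' (hP.tiltedMoment_zero_pos _ _).ne', gaussDensity,
    Real.log_exp]
  ring

lemma IsStandardized.integrable_log_likelihoodRatio (hP : IsStandardized P) (t : ℝ) :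
    Integrable (fun ω : ℝ × ℝ => Real.log (gaussDensity t (ω.1, t * ω.1 + ω.2) /
      tiltedMoment P 0 t (t * ω.1 + ω.2))) (scalarLaw P) := by
  simp only [hP.log_likelihoodRatio]
  exact (((hP.integrable_output_mul_fst t).const_mul _).sub
    (hP.integrable_fst_sq.const_mul _)).sub (hP.integrable_log_tiltedMoment_zero t)

lemma IsStandardized.gaussInfo_eq (hP : IsStandardized P) (t : ℝ) :
    gaussInfo P t = t ^ 2 / 2 -
      ∫ ω : ℝ × ℝ, Real.log (tiltedMoment P 0 t (t * ω.1 + ω.2)) ∂(scalarLaw P) := by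
  simp only [gaussInfo, hP.log_likelihoodRatio]
  rw [integral_sub ?_ (hP.integrable_log_tiltedMoment_zero t),
    integral_sub ((hP.integrable_output_mul_fst t).const_mul _)
    (hP.integrable_fst_sq.const_mul _), integral_const_mul, integral_const_mul,
    hP.integral_output_mul_fst, hP.integral_fst_sq]
  · ring
  · exact ((hP.integrable_output_mul_fst t).const_mul _).sub (hP.integrable_fst_sq.const_mul _)

/-! ### The derivative of the mutual information -/

/-- The derivative, in the amplitude `r`, of the logarithm of the output density at the output
produced by the symbol and noise `ω`. -/
noncomputable def logDensityDeriv (P : Measure ℝ) (r : ℝ) (ω : ℝ × ℝ) : ℝ :=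
  (2 * r * ω.1 + ω.2) * posteriorMoment P 1 r (r * ω.1 + ω.2)
    - r * posteriorMoment P 2 r (r * ω.1 + ω.2)

lemma IsStandardized.hasDerivAt_tiltedMoment_path (hP : IsStandardized P) (ω : ℝ × ℝ) (r₀ : ℝ) :
    HasDerivAt (fun r => tiltedMoment P 0 r (r * ω.1 + ω.2))
      ((2 * r₀ * ω.1 + ω.2) * tiltedMoment P 1 r₀ (r₀ * ω.1 + ω.2)
        - r₀ * tiltedMoment P 2 r₀ (r₀ * ω.1 + ω.2)) r₀ := by
  obtain ⟨x, z⟩ := ω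
  simp only
  set R := |r₀| + 1
  set C := Real.exp ((R * |x| + |z|) ^ 2 / 2)
  have key := hasDerivAt_integral_of_dominated_loc_of_deriv_le (μ := P) (𝕜 := ℝ)
    (F := fun r u => u ^ 0 * gaussDensity r (u, r * x + z))
    (F' := fun r u => (2 * r * x + z) * (u ^ 1 * gaussDensity r (u, r * x + z))
      - r * (u ^ 2 * gaussDensity r (u, r * x + z)))
    (x₀ := r₀) (s := Metric.ball r₀ 1)
    (bound := fun u => (2 * R * |x| + |z|) * (‖u ^ 1‖ * C) + R * (‖u ^ 2‖ * C))
    (Metric.ball_mem_nhds r₀ one_pos)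
    (Filter.Eventually.of_forall fun r =>
      (hP.integrable_tilted (Nat.zero_le 2) r (r * x + z)).aestronglyMeasurable)
    (hP.integrable_tilted (Nat.zero_le 2) r₀ (r₀ * x + z))
    ((((hP.integrable_tilted one_le_two r₀ (r₀ * x + z)).const_mul _).sub
      ((hP.integrable_tilted le_rfl r₀ (r₀ * x + z)).const_mul _)).aestronglyMeasurable)
    (ae_of_all _ fun u r hr => ?_)
    ((((hP.integrable_pow one_le_two).norm.mul_const C).const_mul _).add
      (((hP.integrable_pow le_rfl).norm.mul_const C).const_mul _))
    (ae_of_all _ fun u r _ => ?_)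
  · have h := key.2
    rw [integral_sub ((hP.integrable_tilted one_le_two _ _).const_mul _)
      ((hP.integrable_tilted le_rfl _ _).const_mul _), integral_const_mul, integral_const_mul] at h
    exact h
  · have hr' : |r| ≤ R := by
      have h1 : |r - r₀| < 1 := by simpa [Real.dist_eq] using hr
      have h2 := abs_sub_abs_le_abs_sub r r₀
      simp only [R]; linarith
    have hR : 0 ≤ R := (abs_nonneg r).trans hr'
    have hy : |r * x + z| ≤ R * |x| + |z| := by
      refine (abs_add_le _ _).trans ?_
      rw [abs_mul]
      gcongr
    have hg : ∀ j : ℕ, ‖u ^ j * gaussDensity r (u, r * x + z)‖ ≤ ‖u ^ j‖ * C := fun j => by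
      refine (norm_pow_mul_gaussDensity_le j r u _).trans ?_
      refine mul_le_mul_of_nonneg_left (Real.exp_le_exp.2 ?_) (norm_nonneg _)
      rw [← sq_abs (r * x + z)]
      gcongr
    refine (norm_sub_le _ _).trans ?_
    rw [norm_mul, norm_mul r]
    refine add_le_add (mul_le_mul ?_ (hg 1) (norm_nonneg _) (by positivity))
      (mul_le_mul hr' (hg 2) (norm_nonneg _) hR)
    rw [Real.norm_eq_abs]
    refine (abs_add_le _ _).trans ?_
    rw [abs_mul, abs_mul, abs_two]
    gcongr
  · have h1 : HasDerivAt (fun r => r * u * (r * x + z) - r ^ 2 * u ^ 2 / 2)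
        ((2 * r * x + z) * u - r * u ^ 2) r := by
      have ha : HasDerivAt (fun r : ℝ => r * u) u r := by
        simpa using (hasDerivAt_id r).mul_const u
      have hb : HasDerivAt (fun r : ℝ => r * x + z) x r := by
        simpa using ((hasDerivAt_id r).mul_const x).add_const z
      have hc : HasDerivAt (fun r : ℝ => r ^ 2 * u ^ 2 / 2) (2 * r * u ^ 2 / 2) r := by
        simpa using ((hasDerivAt_pow 2 r).mul_const (u ^ 2)).div_const 2
      refine ((ha.mul hb).sub hc).congr_deriv ?_
      ring
    have h2 := h1.exp
    simp only [gaussDensity, pow_zero, one_mul]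
    refine h2.congr_deriv ?_
    ring

lemma IsStandardized.hasDerivAt_log_tiltedMoment_path (hP : IsStandardized P) (ω : ℝ × ℝ)
    (r : ℝ) :
    HasDerivAt (fun r => Real.log (tiltedMoment P 0 r (r * ω.1 + ω.2)))
      (logDensityDeriv P r ω) r := by
  have h0 := (hP.tiltedMoment_zero_pos r (r * ω.1 + ω.2)).ne'
  refine ((hP.hasDerivAt_tiltedMoment_path ω r).log h0).congr_deriv ?_
  rw [logDensityDeriv, posteriorMoment, posteriorMoment]
  field_simp

lemma IsStandardized.continuous_logDensityDeriv (hP : IsStandardized P) :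
    Continuous fun q : ℝ × ℝ × ℝ => logDensityDeriv P q.1 q.2 := by
  unfold logDensityDeriv
  exact (Continuous.mul (by fun_prop) (hP.continuous_posteriorMoment_output one_le_two)).sub
    (continuous_fst.mul (hP.continuous_posteriorMoment_output le_rfl))

lemma IsStandardized.log_tiltedMoment_path_eq (hP : IsStandardized P) (ω : ℝ × ℝ) (t : ℝ) :
    Real.log (tiltedMoment P 0 t (t * ω.1 + ω.2)) = ∫ r in (0 : ℝ)..t, logDensityDeriv P r ω := by
  have hc : Continuous fun r => logDensityDeriv P r ω :=
    hP.continuous_logDensityDeriv.comp (f := fun r : ℝ => (r, ω)) (by fun_prop)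
  rw [intervalIntegral.integral_eq_sub_of_hasDerivAt
    (fun r _ => hP.hasDerivAt_log_tiltedMoment_path ω r) (hc.intervalIntegrable _ _)]
  simp [tiltedMoment, gaussDensity]

lemma logDensityDeriv_eq (r : ℝ) (ω : ℝ × ℝ) : logDensityDeriv P r ω =
    (r * ω.1 + ω.2) * posteriorMoment P 1 r (r * ω.1 + ω.2)
      + r * (posteriorMoment P 1 r (r * ω.1 + ω.2) * ω.1)
      - r * posteriorMoment P 2 r (r * ω.1 + ω.2) := by
  rw [logDensityDeriv]; ring

lemma IsStandardized.integrable_logDensityDeriv (hP : IsStandardized P) (r : ℝ) :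
    Integrable (logDensityDeriv P r) (scalarLaw P) := by
  have h := ((hP.integrable_output_mul_estimator r).add
    ((hP.integrable_estimator_mul_fst r).const_mul r)).sub
    ((hP.integrable_posteriorMoment_output le_rfl r).const_mul r)
  exact h.congr (ae_of_all _ fun ω => (logDensityDeriv_eq r ω).symm)

lemma IsStandardized.integral_logDensityDeriv (hP : IsStandardized P) (r : ℝ) :
    ∫ ω, logDensityDeriv P r ω ∂(scalarLaw P) = r * estimatorPower P r := by
  simp only [logDensityDeriv_eq]
  rw [integral_sub ?_ ((hP.integrable_posteriorMoment_output le_rfl r).const_mul r),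
    integral_add (hP.integrable_output_mul_estimator r)
    ((hP.integrable_estimator_mul_fst r).const_mul r), integral_const_mul, integral_const_mul,
    hP.integral_output_mul_estimator, hP.integral_estimator_mul_fst,
    hP.integral_posteriorMoment_output le_rfl, hP.power]
  · ring
  · exact (hP.integrable_output_mul_estimator r).add
      ((hP.integrable_estimator_mul_fst r).const_mul r)

lemma IsStandardized.integral_norm_logDensityDeriv_le (hP : IsStandardized P) (r : ℝ) :
    ∫ ω, ‖logDensityDeriv P r ω‖ ∂(scalarLaw P) ≤
      (r ^ 2 + 1) / 2 + |r| / 2 + (1 / 2 + 3 / 2 * |r|) := by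
  have hb : ∀ ω : ℝ × ℝ, ‖logDensityDeriv P r ω‖ ≤ (r * ω.1 + ω.2) ^ 2 / 2 + |r| / 2 * ω.1 ^ 2
      + (1 / 2 + 3 / 2 * |r|) * posteriorMoment P 2 r (r * ω.1 + ω.2) := fun ω => by
    have hv := hP.posteriorMoment_one_sq_le r (r * ω.1 + ω.2)
    rw [logDensityDeriv_eq]
    set y := r * ω.1 + ω.2
    set m := posteriorMoment P 1 r y
    set v := posteriorMoment P 2 r y
    have hv0 : 0 ≤ v := (sq_nonneg m).trans hv
    have h1 : |y * m| ≤ y ^ 2 / 2 + v / 2 := by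
      rw [abs_le]; constructor <;> nlinarith [sq_nonneg (y + m), sq_nonneg (y - m)]
    have h2 : |m * ω.1| ≤ ω.1 ^ 2 / 2 + v / 2 := by
      rw [abs_le]; constructor <;> nlinarith [sq_nonneg (ω.1 + m), sq_nonneg (ω.1 - m)]
    have h3 : |r * (m * ω.1)| ≤ |r| * (ω.1 ^ 2 / 2 + v / 2) := by
      rw [abs_mul]; exact mul_le_mul_of_nonneg_left h2 (abs_nonneg r)
    have h4 : |r * v| = |r| * v := by rw [abs_mul, abs_of_nonneg hv0]
    have h5 := abs_sub (y * m + r * (m * ω.1)) (r * v)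
    have h6 := abs_add_le (y * m) (r * (m * ω.1))
    rw [Real.norm_eq_abs]
    linarith
  have h1 := (hP.integrable_output_sq r).div_const 2
  have h2 := hP.integrable_fst_sq.const_mul (|r| / 2)
  have h3 := (hP.integrable_posteriorMoment_output le_rfl r).const_mul (1 / 2 + 3 / 2 * |r|)
  refine (integral_mono (hP.integrable_logDensityDeriv r).norm ((h1.add h2).add h3) hb).trans_eq ?_
  simp only [Pi.add_apply]
  rw [integral_add ?_ h3, integral_add h1 h2, integral_div, integral_const_mul, integral_const_mul,
    hP.integral_output_sq, hP.integral_fst_sq, hP.integral_posteriorMoment_output le_rfl, hP.power]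
  · ring
  · exact h1.add h2

lemma IsStandardized.integrable_prod_logDensityDeriv (hP : IsStandardized P) (t : ℝ) :
    Integrable (fun q : ℝ × ℝ × ℝ => logDensityDeriv P q.1 q.2)
      ((volume.restrict (Set.Ioc 0 t)).prod (scalarLaw P)) := by
  have hm := hP.continuous_logDensityDeriv.aestronglyMeasurable
    (μ := (volume.restrict (Set.Ioc 0 t)).prod (scalarLaw P))
  refine (integrable_prod_iff hm).2
    ⟨ae_of_all _ fun r => hP.integrable_logDensityDeriv r, ?_⟩
  have hc : Continuous fun r : ℝ => (r ^ 2 + 1) / 2 + |r| / 2 + (1 / 2 + 3 / 2 * |r|) := by fun_prop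
  refine (hc.integrableOn_Ioc (a := 0) (b := t)).mono' hm.norm.integral_prod_right'
    (ae_of_all _ fun r => ?_)
  rw [Real.norm_of_nonneg (integral_nonneg fun _ => norm_nonneg _)]
  exact hP.integral_norm_logDensityDeriv_le r

/-- Integration of the pathwise derivative, with the amplitude and `ω` interchanged. -/
lemma IsStandardized.integral_log_tiltedMoment (hP : IsStandardized P) {t : ℝ} (ht : 0 ≤ t) :
    ∫ ω : ℝ × ℝ, Real.log (tiltedMoment P 0 t (t * ω.1 + ω.2)) ∂(scalarLaw P) =
      ∫ r in (0 : ℝ)..t, r * estimatorPower P r := by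
  simp only [hP.log_tiltedMoment_path_eq, intervalIntegral.integral_of_le ht]
  rw [← integral_integral_swap (f := fun r ω => logDensityDeriv P r ω)
    (hP.integrable_prod_logDensityDeriv t)]
  simp only [hP.integral_logDensityDeriv]

/-- The relation between mutual information and minimum mean-square error, in integrated form. -/
lemma IsStandardized.gaussInfo_sqrt (hP : IsStandardized P) {s : ℝ} (hs : 0 ≤ s) :
    gaussInfo P √s = 1 / 2 * ∫ r in (0 : ℝ)..s, mmse P r := by
  have h0 := Real.sqrt_nonneg s
  have hsub := intervalIntegral.integral_comp_mul_deriv (a := 0) (b := √s)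
    (f := fun r => r ^ 2) (f' := fun r => 2 * r) (g := mmse P)
    (fun r _ => by simpa using hasDerivAt_pow 2 r) (by fun_prop) hP.continuous_mmse
  have hce := hP.continuous_estimatorPower
  rw [Real.sq_sqrt hs, zero_pow two_ne_zero] at hsub
  rw [← hsub, hP.gaussInfo_eq, hP.integral_log_tiltedMoment h0]
  have h1 : ∫ r in (0 : ℝ)..√s, r = √s ^ 2 / 2 := by simp [integral_id]
  rw [← h1, ← intervalIntegral.integral_sub (Continuous.intervalIntegrable (by fun_prop) _ _)
    (Continuous.intervalIntegrable (by fun_prop) _ _), ← intervalIntegral.integral_const_mul]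
  refine intervalIntegral.integral_congr fun r hr => ?_
  rw [Set.uIcc_of_le h0] at hr
  simp only [Function.comp]
  rw [hP.mmse_eq, Real.sqrt_sq hr.1]
  ring

end Information

/-! ### The diagonal vector channel -/

section VectorChannel

/-- A product of probability laws with densities has the product density. -/
lemma pi_withDensity_ofReal {ι : Type*} [Fintype ι] {X : ι → Type*} [∀ i, MeasurableSpace (X i)]
    (ν : ∀ i, Measure (X i)) [∀ i, IsProbabilityMeasure (ν i)] {ρ : ∀ i, X i → ℝ}
    (h0 : ∀ i x, 0 ≤ ρ i x) (hi : ∀ i, Integrable (ρ i) (ν i)) :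
    Measure.pi (fun i => (ν i).withDensity fun x => ENNReal.ofReal (ρ i x)) =
      (Measure.pi ν).withDensity fun x => ENNReal.ofReal (∏ i, ρ i (x i)) := by
  have hfin : ∀ i, IsFiniteMeasure ((ν i).withDensity fun x => ENNReal.ofReal (ρ i x)) :=
    fun i => isFiniteMeasure_withDensity_ofReal (hi i).hasFiniteIntegral
  refine Measure.pi_eq fun s hs => ?_
  rw [withDensity_apply _ (MeasurableSet.univ_pi hs), Measure.restrict_pi_pi,
    ← ofReal_integral_eq_lintegral_ofReal
      (Integrable.fintype_prod_dep fun i => (hi i).restrict)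
      (ae_of_all _ fun x => Finset.prod_nonneg fun i _ => h0 i (x i)),
    integral_fintype_prod_eq_prod,
    ENNReal.ofReal_prod_of_nonneg fun i _ => integral_nonneg fun x => h0 i x]
  refine Finset.prod_congr rfl fun i _ => ?_
  rw [withDensity_apply _ (hs i), ofReal_integral_eq_lintegral_ofReal (hi i).restrict
    (ae_of_all _ fun x => h0 i x)]

variable {K : ℕ} {P : Fin K → Measure ℝ} [∀ k, IsProbabilityMeasure (P k)]

/-- The transition density of parallel Gaussian channels of amplitudes `a`. -/
noncomputable def vecDensity (a : Fin K → ℝ) (p : (Fin K → ℝ) × (Fin K → ℝ)) : ℝ :=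
  ∏ k, gaussDensity (a k) (p.1 k, p.2 k)

lemma vecDensity_pos (a : Fin K → ℝ) (p : (Fin K → ℝ) × (Fin K → ℝ)) : 0 < vecDensity a p :=
  Finset.prod_pos fun _ _ => gaussDensity_pos _ _

lemma measurable_vecDensity (a : Fin K → ℝ) : Measurable (vecDensity a) := by
  unfold vecDensity gaussDensity; fun_prop

lemma received_apply {lam q : Fin K → ℝ} (hlam : ∀ k, 0 ≤ lam k)
    (ω : (Fin K → ℝ) × (Fin K → ℝ)) (k : Fin K) :
    received lam q ω k = √(lam k * q k) * ω.1 k + ω.2 k := by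
  rw [received, Matrix.diagonal_mul_diagonal, Pi.add_apply, Matrix.mulVec_diagonal,
    Real.sqrt_mul (hlam k)]

lemma hasTransitionDensity_received (hP : ∀ k, IsStandardized (P k)) {lam q : Fin K → ℝ}
    (hlam : ∀ k, 0 ≤ lam k) :
    HasTransitionDensity (Measure.pi P) (Measure.pi fun _ : Fin K => gaussianReal 0 1)
      (received lam q) (vecDensity fun k => √(lam k * q k)) := by
  have hr : received lam q = fun ω k => √(lam k * q k) * ω.1 k + ω.2 k :=
    funext fun ω => funext fun k => received_apply hlam ω k
  have hg := fun k => hasTransitionDensity_gauss (hP k) √(lam k * q k)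
  refine .of_map_eq (by rw [hr]; fun_prop) (measurable_vecDensity _) (vecDensity_pos _)
    (fun y => Integrable.fintype_prod_dep
      (f := fun k u => gaussDensity √(lam k * q k) (u, y k)) fun k => (hg k).integrable_density _)
    fun s => ?_
  rw [hr]
  have h := Measure.pi_map_pi (μ := fun _ : Fin K => gaussianReal 0 1)
    (f := fun k z => √(lam k * q k) * s k + z)
    (fun k => (by fun_prop : Measurable fun z => √(lam k * q k) * s k + z).aemeasurable)
  simp only at h ⊢
  rw [h]
  simp only [gaussianReal_map_add_eq_withDensity]
  rw [pi_withDensity_ofReal (fun _ : Fin K => gaussianReal 0 1)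
    (ρ := fun k y => gaussDensity √(lam k * q k) (s k, y))
    (fun k y => (gaussDensity_pos _ _).le) fun k => ?_]
  · rfl
  · have := integrable_gaussDensity_mix √(lam k * q k) (s k) 0 0 1
    simpa using this

lemma outputDensity_vec (a y : Fin K → ℝ) :
    outputDensity (Measure.pi P) (vecDensity a) y = ∏ k, tiltedMoment (P k) 0 (a k) (y k) := by
  rw [outputDensity]
  refine (integral_fintype_prod_eq_prod (fun k u => gaussDensity (a k) (u, y k))).trans ?_
  simp [tiltedMoment]

/-- A symbol is estimated from its own stream alone. -/
lemma posteriorMean_vec (hP : ∀ k, IsStandardized (P k)) (a y : Fin K → ℝ) (k : Fin K) :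
    posteriorMean (Measure.pi P) (vecDensity a) (fun s => s k) y =
      posteriorMoment (P k) 1 (a k) (y k) := by
  have h1 : ∀ s : Fin K → ℝ, s k * vecDensity a (s, y) =
      ∏ i, (if i = k then s i else 1) * gaussDensity (a i) (s i, y i) := fun s => by
    rw [Finset.prod_mul_distrib, Finset.prod_ite_eq' Finset.univ k fun i => s i]
    simp [vecDensity]
  rw [posteriorMean, outputDensity_vec]
  simp only [h1]
  rw [integral_fintype_prod_eq_prod
    (fun i u => (if i = k then u else 1) * gaussDensity (a i) (u, y i)), ← Finset.prod_div_distrib,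
    Finset.prod_eq_single k]
  · simp [posteriorMoment, tiltedMoment]
  · intro i _ hik
    have h0 := ((hP i).tiltedMoment_zero_pos (a i) (y i)).ne'
    simp only [hik, if_false]
    rw [div_eq_one_iff_eq h0]
    simp [tiltedMoment]
  · simp

lemma measurePreserving_stream (k : Fin K) :
    MeasurePreserving (fun ω : (Fin K → ℝ) × (Fin K → ℝ) => (ω.1 k, ω.2 k))
      (symbolNoiseLaw P) (scalarLaw (P k)) :=
  (measurePreserving_eval P k).prod (measurePreserving_eval (fun _ => gaussianReal 0 1) k)

lemma channelMMSE_apply_self (hP : ∀ k, IsStandardized (P k)) {lam q : Fin K → ℝ}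
    (hlam : ∀ k, 0 ≤ lam k) (k : Fin K) :
    channelMMSE P lam q k k = mmse (P k) (lam k * q k) := by
  have hint : Integrable (fun s : Fin K → ℝ => s k) (Measure.pi P) :=
    (measurePreserving_eval P k).integrable_comp_of_integrable (hP k).integrable_id
  have h := (hasTransitionDensity_received (q := q) hP hlam).condMean_ae_eq
    (f := fun s => s k) (measurable_pi_apply k) hint
  set t := √(lam k * q k)
  have hm : Measurable fun ω : ℝ × ℝ =>
      (ω.1 - posteriorMoment (P k) 1 t (t * ω.1 + ω.2)) ^ 2 :=
    (measurable_fst.sub ((hP k).measurable_posteriorMoment_output one_le_two t)).pow_const 2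
  have hmap := integral_map (μ := symbolNoiseLaw P)
    (measurePreserving_stream (P := P) k).measurable.aemeasurable hm.aestronglyMeasurable
  rw [(measurePreserving_stream k).map_eq, (hP k).integral_error_sq] at hmap
  rw [(hP k).mmse_eq, hmap, channelMMSE, mmseMatrix, Matrix.of_apply]
  refine integral_congr_ae ?_
  filter_upwards [h] with ω hω
  rw [posteriorMean_vec hP, received_apply hlam] at hω
  rw [sq]
  exact congrArg₂ _ (congrArg₂ _ rfl hω) (congrArg₂ _ rfl hω)

/-- The streams contribute additively to the mutual information. -/
lemma channelInfo_eq (hP : ∀ k, IsStandardized (P k)) {lam q : Fin K → ℝ}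
    (hlam : ∀ k, 0 ≤ lam k) :
    channelInfo P lam q = ENNReal.ofReal (∑ k, gaussInfo (P k) √(lam k * q k)) := by
  have hκ := hasTransitionDensity_received (q := q) hP hlam
  have hlog : ∀ ω, Real.log (vecDensity (fun k => √(lam k * q k)) (ω.1, received lam q ω) /
      outputDensity (Measure.pi P) (vecDensity fun k => √(lam k * q k)) (received lam q ω)) =
      ∑ k, Real.log (gaussDensity √(lam k * q k) (ω.1 k, √(lam k * q k) * ω.1 k + ω.2 k) /
        tiltedMoment (P k) 0 √(lam k * q k) (√(lam k * q k) * ω.1 k + ω.2 k)) := fun ω => by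
    rw [outputDensity_vec, vecDensity, ← Finset.prod_div_distrib, Real.log_prod fun k _ =>
      (div_pos (gaussDensity_pos _ _) ((hP k).tiltedMoment_zero_pos _ _)).ne']
    simp only [received_apply hlam]
  have hi : ∀ k, Integrable (fun ω : (Fin K → ℝ) × (Fin K → ℝ) =>
      Real.log (gaussDensity √(lam k * q k) (ω.1 k, √(lam k * q k) * ω.1 k + ω.2 k) /
        tiltedMoment (P k) 0 √(lam k * q k) (√(lam k * q k) * ω.1 k + ω.2 k)))
      (symbolNoiseLaw P) := fun k =>
    (measurePreserving_stream k).integrable_comp_of_integrable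
      ((hP k).integrable_log_likelihoodRatio √(lam k * q k))
  rw [channelInfo, symbolNoiseLaw, hκ.mutualInfo_eq]
  · simp only [hlog]
    change ENNReal.ofReal (∫ ω, _ ∂(symbolNoiseLaw P)) = _
    rw [integral_finsetSum _ fun k _ => hi k]
    congr 1
    refine Finset.sum_congr rfl fun k _ => ?_
    have hmap := integral_map (μ := symbolNoiseLaw P)
      (measurePreserving_stream (P := P) k).measurable.aemeasurable
      (f := fun ω => Real.log (gaussDensity √(lam k * q k)
        (ω.1, √(lam k * q k) * ω.1 + ω.2) /
        tiltedMoment (P k) 0 √(lam k * q k) (√(lam k * q k) * ω.1 + ω.2)))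
      (by
        rw [(measurePreserving_stream k).map_eq]
        exact ((hP k).integrable_log_likelihoodRatio _).aestronglyMeasurable)
    rw [(measurePreserving_stream k).map_eq] at hmap
    exact hmap.symm
  · simp only [hlog]
    exact integrable_finsetSum _ fun k _ => hi k

/-- The concave rate function of one stream: half the integral of the minimum mean-square error. -/
noncomputable def rate (P : Measure ℝ) (s : ℝ) : ℝ := 1 / 2 * ∫ r in (0 : ℝ)..s, mmse P r

lemma IsStandardized.hasDerivAt_rate {P : Measure ℝ} [IsProbabilityMeasure P]
    (hP : IsStandardized P) (s : ℝ) : HasDerivAt (rate P) (1 / 2 * mmse P s) s :=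
  (intervalIntegral.integral_hasDerivAt_right (hP.continuous_mmse.intervalIntegrable _ _)
    (hP.continuous_mmse.stronglyMeasurableAtFilter _ _) hP.continuous_mmse.continuousAt).const_mul _

lemma rate_nonneg (P : Measure ℝ) {s : ℝ} (hs : 0 ≤ s) : 0 ≤ rate P s :=
  mul_nonneg (by norm_num) (intervalIntegral.integral_nonneg hs fun r _ => mmse_nonneg P r)

lemma channelInfo_eq_rate (hP : ∀ k, IsStandardized (P k)) {lam q : Fin K → ℝ}
    (hlam : ∀ k, 0 ≤ lam k) (hq : ∀ k, 0 ≤ q k) :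
    channelInfo P lam q = ENNReal.ofReal (∑ k, rate (P k) (lam k * q k)) := by
  rw [channelInfo_eq hP hlam]
  congr 1
  exact Finset.sum_congr rfl fun k _ => (hP k).gaussInfo_sqrt (mul_nonneg (hlam k) (hq k))

end VectorChannel

/-! ### Equivalent forms of the mercury water-filling rule -/

section Waterfilling

variable {P : Measure ℝ} [IsProbabilityMeasure P]

lemma IsStandardized.mmseInv_one (hP : IsStandardized P) : mmseInv P 1 = 0 := by
  rw [← hP.mmse_zero, hP.mmseInv_mmse le_rfl]

lemma IsStandardized.mmseInv_nonneg (hP : IsStandardized P) {ψ : ℝ} (h0 : 0 < ψ) (h1 : ψ ≤ 1) :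
    0 ≤ mmseInv P ψ := by
  obtain ⟨r, hr, rfl⟩ := hP.exists_mmse_eq h0 h1
  rwa [hP.mmseInv_mmse hr]

lemma IsStandardized.waterfilling_eq (hP : IsStandardized P) {l W : ℝ} (hl : 0 < l) (hW : 0 < W) :
    max 0 (W - 1 / l * mercuryFactor P (1 / (W * l))) =
      1 / l * mmseInv P (min 1 (1 / (W * l))) := by
  have hψ : 0 < 1 / (W * l) := by positivity
  rw [mercuryFactor]
  split_ifs with h
  · have h0 := hP.mmseInv_nonneg hψ h
    have e : W - 1 / l * (1 / (1 / (W * l)) - mmseInv P (1 / (W * l))) =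
        1 / l * mmseInv P (1 / (W * l)) := by
      rw [one_div_one_div, mul_sub]
      field_simp
      ring
    rw [e, min_eq_right h, max_eq_right (by positivity)]
  · push Not at h
    have hlt : W * l < 1 := by rwa [lt_div_iff₀ (by positivity), one_mul] at h
    rw [min_eq_left h.le, hP.mmseInv_one, mul_zero, mul_one, max_eq_left]
    rw [sub_nonpos, le_div_iff₀ hl]
    exact hlt.le

lemma IsStandardized.waterfilling_tfae (hP : IsStandardized P) {l W p : ℝ} (hl : 0 < l)
    (hW : 0 < W) (hp : 0 ≤ p) :
    List.TFAE [
      p = max 0 (W - 1 / l * mercuryFactor P (1 / (W * l))),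
      p = 1 / l * mmseInv P (min 1 (1 / (W * l))),
      mmse P (l * p) = min 1 (1 / (l * W)),
      (0 < p ∧ mmse P (l * p) = 1 / (l * W)) ∨ (p = 0 ∧ l * W ≤ 1)] := by
  have hψ : 0 < 1 / (l * W) := by positivity
  have hlp : 0 ≤ l * p := by positivity
  tfae_have 1 ↔ 2 := by rw [hP.waterfilling_eq hl hW]
  tfae_have 2 ↔ 3 := by
    rw [hP.mmse_eq_iff hlp (lt_min one_pos hψ) (min_le_left _ _), mul_comm W l, one_div l,
      eq_inv_mul_iff_mul_eq₀ hl.ne']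
  tfae_have 3 → 4 := by
    intro h
    rcases hp.eq_or_lt with h0 | h0
    · refine Or.inr ⟨h0.symm, ?_⟩
      rw [← h0, mul_zero, hP.mmse_zero] at h
      have := (min_le_right 1 (1 / (l * W))).trans' h.le
      rwa [le_div_iff₀ (by positivity), one_mul] at this
    · refine Or.inl ⟨h0, ?_⟩
      have hlt : mmse P (l * p) < 1 := by
        rw [← hP.mmse_zero]
        exact hP.strictAntiOn_mmse (Set.mem_Ici.2 le_rfl) hlp (by positivity)
      rw [h] at hlt ⊢
      exact min_eq_right ((min_lt_iff.1 hlt).resolve_left (lt_irrefl 1)).le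
  tfae_have 4 → 3 := by
    rintro (⟨-, h⟩ | ⟨h0, h⟩)
    · rw [← h, min_eq_right (hP.mmse_le_one hlp)]
    · rw [h0, mul_zero, hP.mmse_zero, min_eq_left]
      rwa [le_div_iff₀ (by positivity), one_mul]
  tfae_finish

/-- The water-filling rule is the stationarity condition of the rate, with price `1 / (2 * W)`. -/
lemma IsStandardized.waterfilling_iff_stationary (hP : IsStandardized P) {l W p : ℝ} (hl : 0 < l)
    (hW : 0 < W) (hp : 0 ≤ p) :
    p = max 0 (W - 1 / l * mercuryFactor P (1 / (W * l))) ↔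
      1 / 2 * mmse P (l * p) * l ≤ 1 / (2 * W) ∧
        (0 < p → 1 / 2 * mmse P (l * p) * l = 1 / (2 * W)) := by
  refine ((hP.waterfilling_tfae hl hW hp).out 0 3).trans ?_
  have e1 : 1 / 2 * mmse P (l * p) * l = 1 / (2 * W) ↔ mmse P (l * p) = 1 / (l * W) := by
    rw [eq_div_iff (by positivity), eq_div_iff (by positivity)]
    constructor <;> intro h <;> linarith
  constructor
  · rintro (⟨h0, h⟩ | ⟨rfl, h⟩)
    · exact ⟨(e1.2 h).le, fun _ => e1.2 h⟩
    · refine ⟨?_, fun h => absurd h (lt_irrefl 0)⟩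
      rw [mul_zero, hP.mmse_zero, le_div_iff₀ (by positivity)]
      linarith
  · rintro ⟨h1, h2⟩
    rcases hp.eq_or_lt with rfl | h0
    · refine Or.inr ⟨rfl, ?_⟩
      rw [mul_zero, hP.mmse_zero, le_div_iff₀ (by positivity)] at h1
      linarith
    · exact Or.inl ⟨h0, e1.1 (h2 h0)⟩

end Waterfilling

/-! ### Separable concave maximization under cumulative budgets -/

section Budget

variable {X : Type*} [Fintype X] {J : ℕ}

/-- The budget used up to and including stage `l` by the allocation `q`, where `x` belongs to
stage `τ x` and `T` is the unit cost. -/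
noncomputable def cumCost (τ : X → Fin J) (T : ℝ) (q : X → ℝ) (l : Fin J) : ℝ :=
  T * ∑ x with τ x ≤ l, q x

/-- Nonnegative allocations that respect all the cumulative budgets `H`. -/
def WithinBudget (τ : X → Fin J) (T : ℝ) (H : Fin J → ℝ) (q : X → ℝ) : Prop :=
  (∀ x, 0 ≤ q x) ∧ ∀ l, cumCost τ T q l ≤ H l

/-- Allocations that maximize `∑ x, φ x (q x)` within the budgets. -/
def IsBudgetOptimal (τ : X → Fin J) (T : ℝ) (H : Fin J → ℝ) (φ : X → ℝ → ℝ) (q : X → ℝ) : Prop :=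
  WithinBudget τ T H q ∧ ∀ q', WithinBudget τ T H q' → ∑ x, φ x (q' x) ≤ ∑ x, φ x (q x)

variable {τ : X → Fin J} {T : ℝ} {H : Fin J → ℝ} {φ φ' : X → ℝ → ℝ} {q : X → ℝ}

lemma cumCost_add_smul (q d : X → ℝ) (c : ℝ) (l : Fin J) :
    cumCost τ T (fun x => q x + c * d x) l = cumCost τ T q l + c * cumCost τ T d l := by
  simp only [cumCost, Finset.sum_add_distrib, ← Finset.mul_sum]
  ring

lemma continuous_cumCost (l : Fin J) : Continuous fun q : X → ℝ => cumCost τ T q l := by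
  unfold cumCost; fun_prop

/-- A function with strictly decreasing derivative lies below its tangents. -/
lemma lt_tangent_of_strictAntiOn {f f' : ℝ → ℝ} (hf : ∀ s, HasDerivAt f (f' s) s)
    (hf' : StrictAntiOn f' (Set.Ici 0)) {a b : ℝ} (ha : 0 ≤ a) (hb : 0 ≤ b) (hab : a ≠ b) :
    f b < f a + f' a * (b - a) := by
  rcases lt_or_gt_of_ne hab with h | h
  · obtain ⟨c, hc, e⟩ := exists_hasDerivAt_eq_slope f f' h
      (fun x _ => (hf x).continuousAt.continuousWithinAt) fun x _ => hf x
    have h1 : f' c < f' a := hf' ha (Set.mem_Ici.2 (ha.trans hc.1.le)) hc.1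
    rw [e, div_lt_iff₀ (sub_pos.2 h)] at h1
    linarith
  · obtain ⟨c, hc, e⟩ := exists_hasDerivAt_eq_slope f f' h
      (fun x _ => (hf x).continuousAt.continuousWithinAt) fun x _ => hf x
    have h1 : f' a < f' c := hf' (Set.mem_Ici.2 (hb.trans hc.1.le)) ha hc.2
    rw [e, lt_div_iff₀ (sub_pos.2 h)] at h1
    linarith

lemma le_tangent_of_strictAntiOn {f f' : ℝ → ℝ} (hf : ∀ s, HasDerivAt f (f' s) s)
    (hf' : StrictAntiOn f' (Set.Ici 0)) {a b : ℝ} (ha : 0 ≤ a) (hb : 0 ≤ b) :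
    f b ≤ f a + f' a * (b - a) := by
  rcases eq_or_ne a b with rfl | hab
  · simp
  · exact (lt_tangent_of_strictAntiOn hf hf' ha hb hab).le

lemma exists_isBudgetOptimal (hT : 0 < T) (hH : ∀ l, 0 ≤ H l) (hφ : ∀ x, Continuous (φ x)) :
    ∃ q, IsBudgetOptimal τ T H φ q := by
  have hclosed : IsClosed {q : X → ℝ | WithinBudget τ T H q} := by
    have : {q : X → ℝ | WithinBudget τ T H q} =
        (⋂ x, {q | 0 ≤ q x}) ∩ ⋂ l, {q | cumCost τ T q l ≤ H l} := by
      ext q; simp [WithinBudget]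
    rw [this]
    exact (isClosed_iInter fun x => isClosed_le continuous_const (continuous_apply x)).inter
      (isClosed_iInter fun l => isClosed_le (continuous_cumCost l) continuous_const)
  have hsub : {q : X → ℝ | WithinBudget τ T H q} ⊆
      Set.univ.pi fun x => Set.Icc 0 (H (τ x) / T) := by
    intro q hq x _
    refine ⟨hq.1 x, ?_⟩
    rw [le_div_iff₀ hT, mul_comm]
    refine le_trans (mul_le_mul_of_nonneg_left ?_ hT.le) (hq.2 (τ x))
    exact Finset.single_le_sum (f := q) (fun y _ => hq.1 y) (by simp)
  have hcomp : IsCompact {q : X → ℝ | WithinBudget τ T H q} :=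
    (isCompact_univ_pi fun x => isCompact_Icc).of_isClosed_subset hclosed hsub
  have hcont : Continuous fun q : X → ℝ => ∑ x, φ x (q x) :=
    continuous_finsetSum _ fun x _ => (hφ x).comp (continuous_apply x)
  obtain ⟨q, hq, hmax⟩ := hcomp.exists_isMaxOn
    ⟨0, fun x => le_rfl, fun l => by simpa [cumCost] using hH l⟩ hcont.continuousOn
  exact ⟨q, hq, fun q' hq' => hmax hq'⟩

lemma IsBudgetOptimal.eq (hφ : ∀ x s, HasDerivAt (φ x) (φ' x s) s)
    (hanti : ∀ x, StrictAntiOn (φ' x) (Set.Ici 0)) {q₁ q₂ : X → ℝ}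
    (h₁ : IsBudgetOptimal τ T H φ q₁) (h₂ : IsBudgetOptimal τ T H φ q₂) : q₁ = q₂ := by
  by_contra hne
  obtain ⟨x₀, hx₀⟩ := Function.ne_iff.1 hne
  set m : X → ℝ := fun x => q₁ x + 1 / 2 * (q₂ x - q₁ x)
  have hm0 : ∀ x, 0 ≤ m x := fun x => by
    have := h₁.1.1 x; have := h₂.1.1 x; simp only [m]; linarith
  have hm : WithinBudget τ T H m := by
    refine ⟨hm0, fun l => ?_⟩
    have e := cumCost_add_smul (τ := τ) (T := T) q₁ (fun x => q₂ x - q₁ x) (1 / 2) l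
    have e' := cumCost_add_smul (τ := τ) (T := T) q₂ q₁ (-1) l
    have e2 : (fun x => q₂ x + -1 * q₁ x) = fun x => q₂ x - q₁ x := by funext x; ring
    rw [e2] at e'
    have := h₁.1.2 l; have := h₂.1.2 l
    change cumCost τ T (fun x => q₁ x + 1 / 2 * (q₂ x - q₁ x)) l ≤ H l
    linarith
  have hle : ∀ x, φ x (q₁ x) + φ x (q₂ x) ≤ 2 * φ x (m x) := fun x => by
    have a1 := le_tangent_of_strictAntiOn (hφ x) (hanti x) (hm0 x) (h₁.1.1 x)
    have a2 := le_tangent_of_strictAntiOn (hφ x) (hanti x) (hm0 x) (h₂.1.1 x)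
    have e : φ' x (m x) * (q₁ x - m x) + φ' x (m x) * (q₂ x - m x) = 0 := by
      simp only [m]; ring
    linarith
  have hlt : φ x₀ (q₁ x₀) + φ x₀ (q₂ x₀) < 2 * φ x₀ (m x₀) := by
    have hne' : m x₀ ≠ q₁ x₀ := fun h => hx₀ (by simp only [m] at h; linarith)
    have a1 := lt_tangent_of_strictAntiOn (hφ x₀) (hanti x₀) (hm0 x₀) (h₁.1.1 x₀) hne'
    have a2 := le_tangent_of_strictAntiOn (hφ x₀) (hanti x₀) (hm0 x₀) (h₂.1.1 x₀)
    have e : φ' x₀ (m x₀) * (q₁ x₀ - m x₀) + φ' x₀ (m x₀) * (q₂ x₀ - m x₀) = 0 := by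
      simp only [m]; ring
    linarith
  have hsum := Finset.sum_lt_sum (fun x _ => hle x) ⟨x₀, Finset.mem_univ _, hlt⟩
  rw [Finset.sum_add_distrib, ← Finset.mul_sum] at hsum
  have := h₁.2 m hm
  have := h₂.2 m hm
  linarith

/-- Summation by parts of the priced budget. -/
lemma sum_price_mul (ρ : Fin J → ℝ) (d : X → ℝ) :
    ∑ x, T * (∑ l ∈ Finset.Ici (τ x), ρ l) * d x = ∑ l, ρ l * cumCost τ T d l := by
  have h1 : ∀ x, T * (∑ l ∈ Finset.Ici (τ x), ρ l) * d x =
      ∑ l, if τ x ≤ l then ρ l * (T * d x) else 0 := fun x => by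
    rw [← Finset.sum_filter, ← Finset.sum_mul]
    have : Finset.univ.filter (fun l => τ x ≤ l) = Finset.Ici (τ x) := by ext; simp
    rw [this]; ring
  simp only [h1]
  rw [Finset.sum_comm]
  refine Finset.sum_congr rfl fun l _ => ?_
  rw [cumCost, ← Finset.sum_filter, Finset.mul_sum, Finset.mul_sum]

/-- Sufficiency of the Karush-Kuhn-Tucker conditions. -/
lemma isBudgetOptimal_of_prices (hφ : ∀ x s, HasDerivAt (φ x) (φ' x s) s)
    (hanti : ∀ x, StrictAntiOn (φ' x) (Set.Ici 0)) (hq : WithinBudget τ T H q) {ρ : Fin J → ℝ}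
    (hρ : ∀ l, 0 ≤ ρ l) (hslack : ∀ l, ρ l * (cumCost τ T q l - H l) = 0)
    (hle : ∀ x, φ' x (q x) ≤ T * ∑ l ∈ Finset.Ici (τ x), ρ l)
    (heq : ∀ x, 0 < q x → φ' x (q x) = T * ∑ l ∈ Finset.Ici (τ x), ρ l) :
    IsBudgetOptimal τ T H φ q := by
  refine ⟨hq, fun q' hq' => ?_⟩
  have h1 : ∀ x, φ x (q' x) ≤
      φ x (q x) + T * (∑ l ∈ Finset.Ici (τ x), ρ l) * (q' x + -1 * q x) := fun x => by
    refine (le_tangent_of_strictAntiOn (hφ x) (hanti x) (hq.1 x) (hq'.1 x)).trans ?_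
    rcases (hq.1 x).eq_or_lt with h0 | h0
    · rw [← h0]
      have := mul_le_mul_of_nonneg_right (hle x) (hq'.1 x)
      rw [← h0] at this
      linarith
    · rw [heq x h0]
      apply le_of_eq; ring
  have h2 := Finset.sum_le_sum fun x (_ : x ∈ Finset.univ) => h1 x
  rw [Finset.sum_add_distrib, sum_price_mul ρ fun x => q' x + -1 * q x] at h2
  have h3 : ∑ l, ρ l * cumCost τ T (fun x => q' x + -1 * q x) l ≤ 0 := by
    refine Finset.sum_nonpos fun l _ => ?_
    rw [cumCost_add_smul]
    have a := mul_le_mul_of_nonneg_left (hq'.2 l) (hρ l)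
    have b := hslack l
    linarith
  linarith

/-- A small step in a direction that only decreases positive components and only increases the
cost at stages with budget left stays within the budgets. -/
lemma WithinBudget.eventually_add_smul (hq : WithinBudget τ T H q) {d : X → ℝ}
    (h1 : ∀ x, d x < 0 → 0 < q x) (h2 : ∀ l, 0 < cumCost τ T d l → cumCost τ T q l < H l) :
    ∀ᶠ ε in nhdsWithin (0 : ℝ) (Set.Ioi 0), WithinBudget τ T H fun x => q x + ε * d x := by
  have ha : ∀ᶠ ε in nhdsWithin (0 : ℝ) (Set.Ioi 0), ∀ x, 0 ≤ q x + ε * d x := by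
    refine Filter.eventually_all.2 fun x => ?_
    rcases lt_or_ge (d x) 0 with h | h
    · have hc : Continuous fun ε : ℝ => q x + ε * d x := by fun_prop
      have := continuousAt_const.eventually_lt hc.continuousAt
        (show (0 : ℝ) < q x + 0 * d x by simpa using h1 x h)
      exact (this.filter_mono nhdsWithin_le_nhds).mono fun ε hε => hε.le
    · filter_upwards [self_mem_nhdsWithin] with ε hε
      exact add_nonneg (hq.1 x) (mul_nonneg (le_of_lt hε) h)
  have hb : ∀ᶠ ε in nhdsWithin (0 : ℝ) (Set.Ioi 0), ∀ l,
      cumCost τ T q l + ε * cumCost τ T d l ≤ H l := by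
    refine Filter.eventually_all.2 fun l => ?_
    rcases lt_or_ge 0 (cumCost τ T d l) with h | h
    · have hc : Continuous fun ε : ℝ => cumCost τ T q l + ε * cumCost τ T d l := by fun_prop
      have := hc.continuousAt.eventually_lt continuousAt_const
        (show cumCost τ T q l + 0 * cumCost τ T d l < H l by simpa using h2 l h)
      exact (this.filter_mono nhdsWithin_le_nhds).mono fun ε hε => hε.le
    · filter_upwards [self_mem_nhdsWithin] with ε hε
      have := mul_nonpos_of_nonneg_of_nonpos (le_of_lt (Set.mem_Ioi.1 hε)) h
      linarith [hq.2 l]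
  filter_upwards [ha, hb] with ε h3 h4
  exact ⟨h3, fun l => by rw [cumCost_add_smul]; exact h4 l⟩

/-- The objective does not increase to first order in any feasible direction. -/
lemma IsBudgetOptimal.sum_deriv_mul_nonpos (hφ : ∀ x s, HasDerivAt (φ x) (φ' x s) s)
    (hq : IsBudgetOptimal τ T H φ q) {d : X → ℝ} (h1 : ∀ x, d x < 0 → 0 < q x)
    (h2 : ∀ l, 0 < cumCost τ T d l → cumCost τ T q l < H l) :
    ∑ x, φ' x (q x) * d x ≤ 0 := by
  have hd : HasDerivAt (fun ε : ℝ => ∑ x, φ x (q x + ε * d x)) (∑ x, φ' x (q x) * d x) 0 := by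
    refine HasDerivAt.fun_sum fun x _ => ?_
    have ha : HasDerivAt (fun ε : ℝ => q x + ε * d x) (d x) 0 := by
      simpa using ((hasDerivAt_id (0 : ℝ)).mul_const (d x)).const_add (q x)
    exact HasDerivAt.comp (0 : ℝ) (h₂ := φ x) (by simpa using hφ x (q x)) ha
  refine le_of_tendsto hd.tendsto_slope_zero_right ?_
  filter_upwards [hq.1.eventually_add_smul h1 h2, self_mem_nhdsWithin] with ε hε hpos
  have := hq.2 _ hε
  simp only [zero_add, zero_mul, add_zero, smul_eq_mul]
  exact mul_nonpos_of_nonneg_of_nonpos (inv_nonneg.2 (le_of_lt hpos)) (sub_nonpos.2 this)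

variable [DecidableEq X]

lemma cumCost_single (x : X) (l : Fin J) :
    cumCost τ T (Pi.single x 1) l = if τ x ≤ l then T else 0 := by
  rw [cumCost, Finset.sum_filter, Finset.sum_eq_single x]
  · split_ifs <;> simp
  · intro y _ hy
    simp [Pi.single_eq_of_ne hy]
  · simp

/-- An optimal allocation exhausts some budget at or after the stage of a component with positive
marginal value. -/
lemma IsBudgetOptimal.exists_tight (hφ : ∀ x s, HasDerivAt (φ x) (φ' x s) s)
    (hq : IsBudgetOptimal τ T H φ q) {x : X} (hx : 0 < φ' x (q x)) :
    ∃ l, τ x ≤ l ∧ cumCost τ T q l = H l := by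
  by_contra! h
  have key := hq.sum_deriv_mul_nonpos hφ (d := Pi.single x 1)
    (fun y hy => by
      rcases eq_or_ne y x with rfl | hyx
      · norm_num at hy
      · simp [Pi.single_eq_of_ne hyx] at hy)
    (fun l hl => by
      rw [cumCost_single] at hl
      split_ifs at hl with hle
      · exact lt_of_le_of_ne (hq.1.2 l) (h l hle)
      · exact absurd hl (lt_irrefl 0))
  rw [Finset.sum_eq_single x (fun y _ hy => by simp [Pi.single_eq_of_ne hy]) (by simp)] at key
  simp only [Pi.single_eq_same, mul_one] at key
  linarith

/-- Moving cost from `y` to `x` is not profitable when no budget is exhausted in between; in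
particular cost can always be postponed. -/
lemma IsBudgetOptimal.deriv_le_deriv (hT : 0 < T) (hφ : ∀ x s, HasDerivAt (φ x) (φ' x s) s)
    (hq : IsBudgetOptimal τ T H φ q) {x y : X} (hy : 0 < q y)
    (h : ∀ l, τ x ≤ l → l < τ y → cumCost τ T q l < H l) : φ' x (q x) ≤ φ' y (q y) := by
  rcases eq_or_ne x y with rfl | hxy
  · exact le_rfl
  have key := hq.sum_deriv_mul_nonpos hφ
    (d := fun z => (Pi.single x 1 : X → ℝ) z + -1 * (Pi.single y 1 : X → ℝ) z)
    (fun z hz => by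
      rcases eq_or_ne z y with rfl | hzy
      · exact hy
      · rw [Pi.single_eq_of_ne hzy, mul_zero, add_zero] at hz
        rcases eq_or_ne z x with rfl | hzx
        · norm_num at hz
        · simp [Pi.single_eq_of_ne hzx] at hz)
    (fun l hl => by
      rw [cumCost_add_smul, cumCost_single, cumCost_single] at hl
      split_ifs at hl with h1 h2 h2
      · linarith
      · exact h l h1 (not_le.1 h2)
      · linarith
      · linarith)
  simp only [mul_add, Finset.sum_add_distrib] at key
  rw [Finset.sum_eq_single x (fun z _ hz => by simp [Pi.single_eq_of_ne hz]) (by simp),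
    Finset.sum_eq_single y (fun z _ hz => by simp [Pi.single_eq_of_ne hz]) (by simp)] at key
  simp only [Pi.single_eq_same] at key
  linarith

/-- Telescoping of the increments of a function that vanishes at the last stage. -/
lemma sum_Ici_sub_succ (R : ℕ → ℝ) (hR : R J = 0) (j : Fin J) :
    ∑ l ∈ Finset.Ici j, (R l - R (l + 1)) = R j := by
  have h1 : Finset.Ici j = Finset.univ.filter fun l => j ≤ l := by ext; simp
  have h2 : ∑ l : Fin J, (if (j : ℕ) ≤ l then R l - R (l + 1) else 0) =
      ∑ i ∈ Finset.range J, if (j : ℕ) ≤ i then R i - R (i + 1) else 0 :=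
    Fin.sum_univ_eq_sum_range (fun i => if (j : ℕ) ≤ i then R i - R (i + 1) else 0) J
  rw [h1, Finset.sum_filter]
  simp only [Fin.le_def]
  rw [h2, ← Finset.sum_filter]
  have h3 : (Finset.range J).filter (fun i => (j : ℕ) ≤ i) = Finset.Ico (j : ℕ) J := by
    ext i; simp [and_comm]
  have h4 := Finset.sum_Ico_sub R j.2.le
  rw [h3, Finset.sum_congr rfl fun i _ => (neg_sub (R (i + 1)) (R i)).symm,
    Finset.sum_neg_distrib, h4, hR]
  ring

/-- Necessity of the Karush-Kuhn-Tucker conditions. The price of stage `j` is the largest marginal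
value at or after that stage, and the multipliers are its decrements. -/
lemma IsBudgetOptimal.exists_prices [Nonempty X] (hT : 0 < T) (hH : Monotone H)
    (hφ : ∀ x s, HasDerivAt (φ x) (φ' x s) s) (hpos : ∀ x s, 0 ≤ s → 0 < φ' x s)
    (hq : IsBudgetOptimal τ T H φ q) :
    ∃ ρ : Fin J → ℝ, (∀ l, 0 ≤ ρ l) ∧ (∀ l, ρ l * (cumCost τ T q l - H l) = 0) ∧
      (∀ x, φ' x (q x) ≤ T * ∑ l ∈ Finset.Ici (τ x), ρ l) ∧
      ∀ x, 0 < q x → φ' x (q x) = T * ∑ l ∈ Finset.Ici (τ x), ρ l := by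
  set g : X → ℝ := fun x => φ' x (q x)
  have hg : ∀ x, 0 < g x := fun x => hpos x _ (hq.1.1 x)
  set R : ℕ → ℝ := fun m => ⨆ x, if m ≤ (τ x : ℕ) then g x else 0
  have hle : ∀ m x, (if m ≤ (τ x : ℕ) then g x else 0) ≤ R m := fun m x =>
    le_ciSup (f := fun x => if m ≤ (τ x : ℕ) then g x else 0) (Set.finite_range _).bddAbove x
  have hgR : ∀ m x, m ≤ (τ x : ℕ) → g x ≤ R m := fun m x h => by
    have := hle m x; rwa [if_pos h] at this
  have hR0 : ∀ m, 0 ≤ R m := fun m => by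
    obtain ⟨x⟩ := ‹Nonempty X›
    refine le_trans ?_ (hle m x)
    split_ifs
    exacts [(hg x).le, le_rfl]
  have hatt : ∀ m, R m = 0 ∨ ∃ x, m ≤ (τ x : ℕ) ∧ R m = g x := fun m => by
    obtain ⟨x, hx⟩ := exists_eq_ciSup_of_finite (f := fun x => if m ≤ (τ x : ℕ) then g x else 0)
    split_ifs at hx with h
    · exact Or.inr ⟨x, h, hx.symm⟩
    · exact Or.inl hx.symm
  have hRJ : R J = 0 := by
    rcases hatt J with h | ⟨x, h, -⟩
    · exact h
    · exact absurd (τ x).2 (not_lt.2 h)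
  have hanti : ∀ m, R (m + 1) ≤ R m := fun m => by
    rcases hatt (m + 1) with h | ⟨x, h, e⟩
    · rw [h]; exact hR0 m
    · rw [e]; exact hgR m x (by omega)
  have hsum : ∀ j : Fin J, T * ∑ l ∈ Finset.Ici j, (R l - R (l + 1)) / T = R j := fun j => by
    rw [← Finset.sum_div, mul_div_cancel₀ _ hT.ne', sum_Ici_sub_succ R hRJ]
  refine ⟨fun l => (R l - R (l + 1)) / T, fun l => div_nonneg (sub_nonneg.2 (hanti l)) hT.le,
    fun l => ?_, fun x => ?_, fun x hx => ?_⟩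
  · rcases (hq.1.2 l).eq_or_lt with htight | hl
    · rw [htight, sub_self, mul_zero]
    -- With budget left at stage `l`, the price does not drop after stage `l`.
    have hdrop : R l ≤ R (l + 1) := by
      rcases hatt l with h | ⟨x, hx, e⟩
      · rw [h]; exact hR0 _
      rw [e]
      by_cases hx' : (l : ℕ) + 1 ≤ τ x
      · exact hgR _ x hx'
      have hxl : τ x = l := Fin.ext (by omega)
      -- The first exhausted budget after stage `l` is spent partly after stage `l`.
      have hne : (Finset.univ.filter fun m => l ≤ m ∧ cumCost τ T q m = H m).Nonempty := by
        obtain ⟨m, hm1, hm2⟩ := hq.exists_tight hφ (hg x)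
        exact ⟨m, by simp [← hxl, hm1, hm2]⟩
      obtain ⟨m, hm, hmin⟩ := Finset.exists_minimal hne
      simp only [Finset.mem_filter, Finset.mem_univ, true_and] at hm hmin
      have hy : ∃ y, l < τ y ∧ τ y ≤ m ∧ 0 < q y := by
        by_contra! hno
        have hsub : (Finset.univ.filter fun x => τ x ≤ l) ⊆
            Finset.univ.filter fun x => τ x ≤ m := fun y hy => by
          simp only [Finset.mem_filter, Finset.mem_univ, true_and] at hy ⊢
          exact hy.trans hm.1
        have heq : cumCost τ T q l = cumCost τ T q m := by
          rw [cumCost, cumCost, Finset.sum_subset hsub fun y hy hy' => ?_]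
          simp only [Finset.mem_filter, Finset.mem_univ, true_and, not_le] at hy hy'
          exact le_antisymm (hno y hy' hy) (hq.1.1 y)
        have := hH hm.1
        rw [← hm.2, ← heq] at this
        linarith
      obtain ⟨y, hy1, hy2, hy3⟩ := hy
      refine (hq.deriv_le_deriv hT hφ (x := x) hy3 fun l' h1 h2 => ?_).trans
        (hgR _ y (Nat.succ_le_of_lt hy1))
      refine lt_of_le_of_ne (hq.1.2 l') fun htight => ?_
      have hlt : l' < m := h2.trans_le hy2
      exact absurd (hmin ⟨hxl ▸ h1, htight⟩ hlt.le) (not_le.2 hlt)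
    simp only
    rw [le_antisymm hdrop (hanti l), sub_self, zero_div, zero_mul]
  · rw [hsum]
    exact hgR _ x le_rfl
  · rw [hsum]
    refine le_antisymm (hgR _ x le_rfl) ?_
    rcases hatt (τ x) with h | ⟨x', hx', e⟩
    · rw [h]; exact (hg x).le
    · rw [e]
      exact hq.deriv_le_deriv hT hφ hx fun l h1 h2 =>
        absurd (h1.trans_lt h2) (not_lt.2 (Fin.le_def.2 hx'))

end Budget

/-! ### The throughput problem as a budgeted maximization -/

section Throughput

variable {K N J : ℕ} {P : Fin K → Measure ℝ} {lam : Fin K → Fin N → ℝ} {Ts : ℝ} {E : Fin J → ℝ}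
  {e : Fin J → Fin N} {τ : Fin N → Fin J}

lemma mem_pool {n : Fin N} {j : Fin J} : n ∈ pool e j ↔ e j ≤ n ∧ ∀ i, j < i → n < e i := by
  simp [pool]

lemma mem_pool_self (he : StrictMono e) (j : Fin J) : e j ∈ pool e j :=
  mem_pool.2 ⟨le_rfl, fun _ hi => he hi⟩

/-- The pools partition the channel uses: `τ n` is the pool of the channel use `n`. -/
lemma exists_poolIndex [NeZero N] [NeZero J] (he0 : e 0 = 0) :
    ∃ τ : Fin N → Fin J, ∀ n j, n ∈ pool e j ↔ τ n = j := by
  have hex : ∀ n, ∃ j, n ∈ pool e j := fun n => by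
    obtain ⟨j, hj, hmax⟩ := Finset.exists_max_image
      (Finset.univ.filter fun j => e j ≤ n) (fun j => j) ⟨0, by simp [he0]⟩
    simp only [Finset.mem_filter, Finset.mem_univ, true_and] at hj hmax
    exact ⟨j, mem_pool.2 ⟨hj, fun i hi => not_le.1 fun h => absurd (hmax i h) (not_le.2 hi)⟩⟩
  choose τ hτ using hex
  refine ⟨τ, fun n j => ⟨fun h => ?_, fun h => h ▸ hτ n⟩⟩
  have h1 := mem_pool.1 h
  have h2 := mem_pool.1 (hτ n)
  rcases lt_trichotomy (τ n) j with hlt | heq | hlt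
  · exact absurd (h2.2 j hlt) (not_lt.2 h1.1)
  · exact heq
  · exact absurd (h1.2 _ hlt) (not_lt.2 h2.1)

lemma sum_pool {M : Type*} [AddCommMonoid M] (hτ : ∀ n j, n ∈ pool e j ↔ τ n = j)
    (S : Finset (Fin J)) (f : Fin N → M) :
    ∑ j ∈ S, ∑ n ∈ pool e j, f n = ∑ n with τ n ∈ S, f n := by
  have h : ∀ j, pool e j = Finset.univ.filter fun n => τ n = j := fun j => by
    ext n; simp [hτ]
  simp only [h]
  rw [← Finset.sum_fiberwise_of_maps_to (s := Finset.univ.filter fun n => τ n ∈ S) (t := S) (g := τ)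
    fun n hn => (Finset.mem_filter.1 hn).2]
  refine Finset.sum_congr rfl fun j hj => Finset.sum_congr ?_ fun _ _ => rfl
  ext n
  simp only [Finset.mem_filter, Finset.mem_univ, true_and]
  exact ⟨fun h => ⟨h ▸ hj, h⟩, fun h => h.2⟩

lemma spentEnergy_eq_cumCost (hτ : ∀ n j, n ∈ pool e j ↔ τ n = j) (p : Fin K → Fin N → ℝ)
    (l : Fin J) :
    spentEnergy Ts e p l =
      cumCost (fun x : Fin K × Fin N => τ x.2) Ts (fun x => p x.1 x.2) l := by
  rw [spentEnergy, cumCost, sum_pool hτ, Finset.sum_filter, Finset.sum_filter,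
    Fintype.sum_prod_type_right]
  congr 1
  refine Finset.sum_congr rfl fun n _ => ?_
  by_cases h : τ n ≤ l <;> simp [h]

lemma isFeasible_iff_withinBudget (hτ : ∀ n j, n ∈ pool e j ↔ τ n = j) (p : Fin K → Fin N → ℝ) :
    IsFeasible Ts E e p ↔ WithinBudget (fun x : Fin K × Fin N => τ x.2) Ts (harvestedEnergy E)
      (fun x => p x.1 x.2) := by
  simp only [IsFeasible, WithinBudget, spentEnergy_eq_cumCost hτ, Prod.forall]

lemma totalInfo_eq [∀ k, IsProbabilityMeasure (P k)] (hP : ∀ k, IsStandardized (P k))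
    (hlam : ∀ k n, 0 < lam k n) (hτ : ∀ n j, n ∈ pool e j ↔ τ n = j) {p : Fin K → Fin N → ℝ}
    (hp : ∀ k n, 0 ≤ p k n) :
    totalInfo P lam e p = ENNReal.ofReal
      (∑ x : Fin K × Fin N, rate (P x.1) (lam x.1 x.2 * p x.1 x.2)) := by
  have h0 : ∀ k n, 0 ≤ rate (P k) (lam k n * p k n) := fun k n =>
    rate_nonneg _ (mul_nonneg (hlam k n).le (hp k n))
  rw [totalInfo, sum_pool hτ, Fintype.sum_prod_type_right,
    ENNReal.ofReal_sum_of_nonneg fun n _ => Finset.sum_nonneg fun k _ => h0 k n]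
  simp only [Finset.mem_univ, Finset.filter_true]
  exact Finset.sum_congr rfl fun n _ =>
    channelInfo_eq_rate hP (fun k => (hlam k n).le) fun k => hp k n

lemma isOptimal_iff_isBudgetOptimal [∀ k, IsProbabilityMeasure (P k)]
    (hP : ∀ k, IsStandardized (P k)) (hlam : ∀ k n, 0 < lam k n)
    (hτ : ∀ n j, n ∈ pool e j ↔ τ n = j) (p : Fin K → Fin N → ℝ) :
    IsOptimal P lam Ts E e p ↔
      IsBudgetOptimal (fun x : Fin K × Fin N => τ x.2) Ts (harvestedEnergy E)
        (fun x s => rate (P x.1) (lam x.1 x.2 * s)) (fun x => p x.1 x.2) := by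
  have h0 : ∀ q : Fin K → Fin N → ℝ, (∀ k n, 0 ≤ q k n) →
      0 ≤ ∑ x : Fin K × Fin N, rate (P x.1) (lam x.1 x.2 * q x.1 x.2) := fun q hq =>
    Finset.sum_nonneg fun x _ => rate_nonneg _ (mul_nonneg (hlam x.1 x.2).le (hq x.1 x.2))
  rw [IsOptimal, IsBudgetOptimal, isFeasible_iff_withinBudget hτ]
  refine and_congr_right fun hp => ⟨fun h q hq => ?_, fun h q hq => ?_⟩
  · have hq' : IsFeasible Ts E e fun k n => q (k, n) := (isFeasible_iff_withinBudget hτ _).2 hq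
    have := h _ hq'
    rw [totalInfo_eq hP hlam hτ hq'.1, totalInfo_eq hP hlam hτ fun k n => hp.1 (k, n),
      ENNReal.ofReal_le_ofReal_iff (h0 p fun k n => hp.1 (k, n))] at this
    exact this
  · rw [totalInfo_eq hP hlam hτ hq.1, totalInfo_eq hP hlam hτ fun k n => hp.1 (k, n)]
    exact ENNReal.ofReal_le_ofReal
      (h (fun x => q x.1 x.2) ((isFeasible_iff_withinBudget hτ q).1 hq))

lemma monotone_harvestedEnergy (hE : ∀ j, 0 ≤ E j) : Monotone (harvestedEnergy E) := fun _ _ h =>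
  Finset.sum_le_sum_of_subset_of_nonneg (Finset.Iic_subset_Iic.2 h) fun j _ _ => hE j

lemma one_div_two_mul_waterLevel (ρ : Fin J → ℝ) (j : Fin J) :
    1 / (2 * waterLevel Ts ρ j) = Ts * ∑ l ∈ Finset.Ici j, ρ l := by
  rw [waterLevel, mul_assoc, mul_one_div, div_mul_cancel_left₀ two_ne_zero, one_div, inv_inv]

variable {Q : Measure ℝ} [IsProbabilityMeasure Q] {l : ℝ}

lemma hasDerivAt_rate_mul (hQ : IsStandardized Q) (l s : ℝ) :
    HasDerivAt (fun s => rate Q (l * s)) (1 / 2 * mmse Q (l * s) * l) s := by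
  have h : HasDerivAt (fun s : ℝ => l * s) l s := by
    simpa using (hasDerivAt_id s).const_mul l
  exact (hQ.hasDerivAt_rate (l * s)).comp s h

lemma strictAntiOn_marginalRate (hQ : IsStandardized Q) (hl : 0 < l) :
    StrictAntiOn (fun s => 1 / 2 * mmse Q (l * s) * l) (Set.Ici 0) := fun a ha b hb hab => by
  have := hQ.strictAntiOn_mmse (Set.mem_Ici.2 (mul_nonneg hl.le ha))
    (Set.mem_Ici.2 (mul_nonneg hl.le hb)) (mul_lt_mul_of_pos_left hab hl)
  have := mul_lt_mul_of_pos_right this hl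
  simp only
  linarith

lemma marginalRate_pos (hQ : IsStandardized Q) (hl : 0 < l) {s : ℝ} (hs : 0 ≤ s) :
    0 < 1 / 2 * mmse Q (l * s) * l := by
  have := hQ.mmse_pos (mul_nonneg hl.le hs)
  positivity

end Throughput

end EnergyHarvesting

open EnergyHarvesting in
theorem mainTheorem2 {K N J : ℕ} [NeZero K] [NeZero N] [NeZero J]
    -- the laws of the zero-mean, unit-power symbols of the streams
    (P : Fin K → Measure ℝ) [∀ k, IsProbabilityMeasure (P k)]
    (hmean : ∀ k, ∫ x, x ∂(P k) = 0) (hpower : ∀ k, ∫ x, x ^ 2 ∂(P k) = 1)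
    -- the channel gains
    (lam : Fin K → Fin N → ℝ) (hlam : ∀ k n, 0 < lam k n)
    -- symbol duration, harvested energies, arrival instants (the first one is the first access)
    (Ts : ℝ) (hTs : 0 < Ts) (E : Fin J → ℝ) (hE : ∀ j, 0 ≤ E j)
    (e : Fin J → Fin N) (he : StrictMono e) (he0 : e 0 = 0) :
    -- the optimal allocation exists and is unique
    (∃! p : Fin K → Fin N → ℝ, IsOptimal P lam Ts E e p) ∧
    -- it is the feasible mercury water-flowing allocation
    (∀ p : Fin K → Fin N → ℝ, IsOptimal P lam Ts E e p ↔
      IsFeasible Ts E e p ∧ ∃ ρ : Fin J → ℝ,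
        (∀ l, 0 ≤ ρ l) ∧
        (∀ l, ρ l * (spentEnergy Ts e p l - harvestedEnergy E l) = 0) ∧
        (∀ j, 0 < waterLevel Ts ρ j) ∧
        ∀ k j, ∀ n ∈ pool e j,
          p k n = max 0 (waterLevel Ts ρ j -
            1 / lam k n * mercuryFactor (P k) (1 / (waterLevel Ts ρ j * lam k n)))) ∧
    -- equivalent forms of the allocation, for any positive water levels
    (∀ p : Fin K → Fin N → ℝ, (∀ k n, 0 ≤ p k n) → ∀ W : Fin J → ℝ, (∀ j, 0 < W j) →
      ∀ k j, ∀ n ∈ pool e j, List.TFAE [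
        p k n = max 0 (W j - 1 / lam k n * mercuryFactor (P k) (1 / (W j * lam k n))),
        p k n = 1 / lam k n * mmseInv (P k) (min 1 (1 / (W j * lam k n))),
        channelMMSE P (fun i => lam i n) (fun i => p i n) k k = min 1 (1 / (lam k n * W j)),
        (0 < p k n ∧
            channelMMSE P (fun i => lam i n) (fun i => p i n) k k = 1 / (lam k n * W j)) ∨
          (p k n = 0 ∧ lam k n * W j ≤ 1)]) := by
  have hP : ∀ k, IsStandardized (P k) := fun k => ⟨hmean k, hpower k⟩
  obtain ⟨τ, hτ⟩ := exists_poolIndex he0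
  have hopt := isOptimal_iff_isBudgetOptimal (E := E) hP hlam hτ (Ts := Ts)
  have hH := monotone_harvestedEnergy hE
  have hH0 : ∀ l, 0 ≤ harvestedEnergy E l := fun l => Finset.sum_nonneg fun j _ => hE j
  have hφ := fun x : Fin K × Fin N => hasDerivAt_rate_mul (hP x.1) (lam x.1 x.2)
  have hanti := fun x : Fin K × Fin N => strictAntiOn_marginalRate (hP x.1) (hlam x.1 x.2)
  have hpos := fun (x : Fin K × Fin N) (s : ℝ) => marginalRate_pos (s := s) (hP x.1) (hlam x.1 x.2)
  have hne : Nonempty (Fin K × Fin N) := ⟨(0, 0)⟩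
  refine ⟨?_, fun p => ⟨fun hp => ?_, ?_⟩, fun p hp W hW k j n hn => ?_⟩
  · obtain ⟨q, hq⟩ := exists_isBudgetOptimal (τ := fun x : Fin K × Fin N => τ x.2) hTs hH0
      fun x => continuous_iff_continuousAt.2 fun s => (hφ x s).continuousAt
    refine ⟨fun k n => q (k, n), (hopt _).2 hq, fun p hp => ?_⟩
    have h := ((hopt p).1 hp).eq hφ hanti hq
    funext k n
    exact congrFun h (k, n)
  · obtain ⟨ρ, h0, hslack, hle, heq⟩ := ((hopt p).1 hp).exists_prices hTs hH hφ hpos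
    -- Every pool contains a channel use, whose marginal rates are positive.
    have hR : ∀ j, 0 < Ts * ∑ l ∈ Finset.Ici j, ρ l := fun j => by
      have hj : τ (e j) = j := (hτ _ _).1 (mem_pool_self he j)
      have := (hpos (0, e j) _ (hp.1.1 0 (e j))).trans_le (hle (0, e j))
      simpa only [hj] using this
    have hW : ∀ j, 0 < waterLevel Ts ρ j := fun j => by
      rw [waterLevel, mul_assoc]; have := hR j; positivity
    refine ⟨hp.1, ρ, h0, fun l => ?_, hW, fun k j n hn => ?_⟩
    · rw [spentEnergy_eq_cumCost hτ]; exact hslack l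
    · have hj : τ n = j := (hτ n j).1 hn
      refine ((hP k).waterfilling_iff_stationary (hlam k n) (hW j) (hp.1.1 k n)).2 ?_
      rw [one_div_two_mul_waterLevel, ← hj]
      exact ⟨hle (k, n), heq (k, n)⟩
  · rintro ⟨hf, ρ, h0, hslack, hW, hform⟩
    have hst := fun x : Fin K × Fin N =>
      ((hP x.1).waterfilling_iff_stationary (hlam x.1 x.2) (hW (τ x.2)) (hf.1 x.1 x.2)).1
        (hform x.1 (τ x.2) x.2 ((hτ _ _).2 rfl))
    simp only [one_div_two_mul_waterLevel] at hst
    exact (hopt p).2 (isBudgetOptimal_of_prices hφ hanti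
      ((isFeasible_iff_withinBudget hτ p).1 hf) h0
      (fun l => by rw [← spentEnergy_eq_cumCost hτ]; exact hslack l)
      (fun x => (hst x).1) fun x => (hst x).2)
  · rw [channelMMSE_apply_self hP fun i => (hlam i n).le]
    exact (hP k).waterfilling_tfae (hlam k n) (hW j) (hp k n)
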